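/- **Setting.** Let $G=(V,E)$ be a connected simple undirected graph with $V=\{1,\dots,n\}$. One observes $Y_i=\mu^*_i+\varepsilon_i$, $i\in V$, where the $\varepsilon_i$ are centred, i.i.d. and sub-Gaussian with parameter $\sigma>0$, i.e. $\mathbb{E}e^{t\varepsilon_i}\le e^{\sigma^2t^2/2}$ for all $t\in\mathbb{R}$. There is a partition $\mathcal{S}^*=\{S_1^*,S_2^*\}$ of $V$ into $K^*=2$ nonempty sets (not necessarily connected) such that $\mu^*$ takes the value $f_k^*$ on $S_k^*$, and $f_1^*\ne f_2^*$. Put $\Delta=\min(|S_1^*|,|S_2^*|)$ and $\kappa=|f_1^*-f_2^*|$. For $e\in E$ let $r(e)$ be the effective resistance, i.e. the proportion of spanning trees of $G$ that contain $e$, and let $w:E\to\mathbb{R}_+$ satisfy $w\ge r$ on $E$. Write $w(|E|)=\sum_{e\in E}w(e)$, and for a partition $\mathcal{S}$ let $|\partial_w(\mathcal{S})|$ be the sum of $w(e)$ over the edges $e$ whose endpoints lie in different elements of $\mathcal{S}$. For partitions $\mathcal{A},\mathcal{B}$ of $V$ let $d_{\mathrm H}(\mathcal{A},\mathcal{B})=\max\{\max_{A\in\mathcal{A}}\min_{B\in\mathcal{B}}|A\triangle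 B|,\ \max_{B\in\mathcal{B}}\min_{A\in\mathcal{A}}|A\triangle B|\}$. The partition induced by a vector is the partition of $V$ into its level sets. **Algorithm.** Let $F_w(\mu)=\frac12\|Y-\mu\|^2+\lambda\sum_{\{i,j\}\in E}w(i,j)\mathbf 1\{\mu_i\ne\mu_j\}$, let $\delta>0$, $\tau\ge0$, and let $\widehat\mu^{(0)}$ be the constant vector with value $\overline Y=n^{-1}\sum_iY_i$. Set $\mu_1=0$ and $\mathrm{FLAG}=0$. For each $c\in\delta\mathbb{Z}\cap[\min_iY_i,\max_iY_i]$ (in any order) let $\widetilde\mu$ be the result of the $\alpha$-expansion of $\widehat\mu^{(0)}$ with value $c$ (below). If $F_w(\widetilde\mu)\le F_w(\widehat\mu^{(0)})-\tau$, set $\mathrm{FLAG}=1$ and, if moreover $F_w(\widetilde\mu)\le F_w(\mu_1)$, set $\mu_1=\widetilde\mu$. At the end output $\mu_1$ if $\mathrm{FLAG}=1$ and $\widehat\mu^{(0)}$ otherwise. The $\alpha$-expansion of a vector $\mu$ with value $c$ is computed from a minimum $s$-$t$-cut of the following undirected graph with vertices $V\cup\{s,t\}$ and one extra vertex $a_{ij}$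 for each $\{i,j\}\in E$ with $\mu_i\neq\mu_j$. The capacity of $\{s,i\}$ is $\frac12(Y_i-c)^2$; that of $\{t,i\}$ is $\frac12(Y_i-\mu_i)^2$ if $\mu_i\ne c$ and $\infty$ if $\mu_i=c$; that of $\{i,j\}\in E$ with $\mu_i=\mu_j$ is $\lambda w(i,j)\mathbf 1\{\mu_i\ne c\}$; and an edge $\{i,j\}\in E$ with $\mu_i\ne\mu_j$ is replaced by $\{i,a_{ij}\}$, $\{j,a_{ij}\}$, $\{t,a_{ij}\}$ with capacities $\lambda w(i,j)\mathbf 1\{\mu_i\ne c\}$, $\lambda w(i,j)\mathbf 1\{\mu_j\ne c\}$, $\lambda w(i,j)$. The result is the vector that equals $\mu_i$ at the vertices $i$ on the side of $s$ and $c$ at the vertices on the side of $t$. **Theorem.** There are absolute constants $c>0$ and $C_0>0$ such that for every $C_\lambda\ge C_0$ there is a constant $C>0$, depending only on $C_\lambda$, with the following property. Let $C_{\mathrm{SNR}}>0$ and let $(\zeta_n)_n$ be any real sequence with $\zeta_n\to\infty$. Then there is an $N$ such that, for all $n\ge N$ and all $G$, $w$, $\sigma$, $\mu^*$, $\mathcal{S}^*$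 and noise distributions as above with $$\kappa^2\Delta\ \ge\ C_{\mathrm{SNR}}\,\sigma^2\,|\partial_w(\mathcal{S}^*)|\,\log\{w(|E|)\}\,\zeta_n ,$$ and for all $0<\delta\le\sigma/\sqrt n$, $0\le\tau\le\sigma^2$ and $\lambda=C_\lambda\sigma^2\log\{w(|E|)\}$, it holds with probability at least $1-\{w(|E|)\}^{-c}$ that for every output $\widehat\mu$ of the algorithm (whatever the order of the values $c$ and the choice among minimum cuts) the partition $\widehat{\mathcal{S}}$ induced by $\widehat\mu$ satisfies $$d_{\mathrm H}(\widehat{\mathcal{S}},\mathcal{S}^*)\ \le\ C\,\kappa^{-2}\,\sigma^2\,|\partial_w(\mathcal{S}^*)|\,\log\{w(|E|)\}.$$ -/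

import Mathlib

open MeasureTheory ProbabilityTheory Filter

noncomputable section

section GraphQuantities

variable {V : Type*} [Fintype V] [DecidableEq V]

/-- The spanning trees of `G`: the subgraphs of `G` on all of `V` that are trees. -/
def spanningTrees (G : SimpleGraph V) : Set (SimpleGraph V) :=
  {T | T ≤ G ∧ T.IsTree}

/-- Effective resistance weight of an edge `e`: the proportion of spanning trees that include `e`. -/
def effectiveResistance (G : SimpleGraph V) (e : Sym2 V) : ℝ :=
  ({T | T ∈ spanningTrees G ∧ e ∈ T.edgeSet}.ncard : ℝ) / ((spanningTrees G).ncard : ℝ)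

open Classical in
/-- `w(|E|)`, the sum of the weights of all (undirected) edges. -/
def totalWeight (G : SimpleGraph V) (w : Sym2 V → ℝ) : ℝ :=
  ∑ e ∈ G.edgeFinset, w e

open Classical in
/-- `|∂_w(𝒮)|`: the sum of the weights of the edges whose endpoints lie in different elements
of the partition `𝒮`. -/
def boundaryWeight (G : SimpleGraph V) (w : Sym2 V → ℝ)
    (𝒮 : Finpartition (Finset.univ : Finset V)) : ℝ :=
  ∑ e ∈ G.edgeFinset with ¬ ∃ A ∈ 𝒮.parts, ∀ i ∈ e, i ∈ A, w e

/-- Two vertex sets are joined by at least one edge. -/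
def Touch (G : SimpleGraph V) (A B : Finset V) : Prop :=
  ∃ i ∈ A, ∃ j ∈ B, G.Adj i j

/-- `Δ`, the size of the smallest element of the partition. -/
def minPieceSize (𝒮 : Finpartition (Finset.univ : Finset V)) : ℕ :=
  ⨅ A : 𝒮.parts, (A : Finset V).card

/-- `κ`, the smallest jump `|f_k - f_l|` over pairs of distinct elements of the partition that are
joined by an edge; `f A` is the signal value on the element `A`. -/
def minJump (G : SimpleGraph V) (𝒮 : Finpartition (Finset.univ : Finset V))
    (f : Finset V → ℝ) : ℝ :=
  sInf {x | ∃ A ∈ 𝒮.parts, ∃ B ∈ 𝒮.parts, A ≠ B ∧ Touch G A B ∧ x = |f A - f B|}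

/-- One-sided distance `max_{A ∈ 𝒜} min_{B ∈ ℬ} |A ∆ B|`. -/
def hausdorffOneSided (𝒜 ℬ : Finpartition (Finset.univ : Finset V)) : ℕ :=
  𝒜.parts.sup fun A => ⨅ B : ℬ.parts, (symmDiff A (B : Finset V)).card

/-- Hausdorff distance between two partitions of `V`. -/
def partitionDist (𝒜 ℬ : Finpartition (Finset.univ : Finset V)) : ℕ :=
  max (hausdorffOneSided 𝒜 ℬ) (hausdorffOneSided ℬ 𝒜)

open Classical in
/-- The partition of `V` induced by a vector: its nonempty level sets. -/
def inducedPartition (v : V → ℝ) : Finpartition (Finset.univ : Finset V) :=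
  Finpartition.ofSetoid (Setoid.ker v)

end GraphQuantities

/-- The graph-structured change point model `Y = μ + ε`: the graph is connected, `μ` equals `f A`
on each element `A` of `𝒮`, elements joined by an edge carry different values, and the errors are
centred, i.i.d. and sub-Gaussian with variance proxy `σ²`. -/
structure IsChangePointModel {V Ω : Type*} [Fintype V] [DecidableEq V] [MeasurableSpace Ω]
    (G : SimpleGraph V) (P : Measure Ω) (Y : V → Ω → ℝ) (μ : V → ℝ)
    (𝒮 : Finpartition (Finset.univ : Finset V)) (f : Finset V → ℝ) (σ : ℝ) : Prop where
  connected : G.Connected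
  sigma_pos : 0 < σ
  piecewise_const : ∀ A ∈ 𝒮.parts, ∀ i ∈ A, μ i = f A
  jump : ∀ A ∈ 𝒮.parts, ∀ B ∈ 𝒮.parts, A ≠ B → Touch G A B → f A ≠ f B
  indep : iIndepFun (fun i ω => Y i ω - μ i) P
  identDistrib : ∀ i j, IdentDistrib (fun ω => Y i ω - μ i) (fun ω => Y j ω - μ j) P P
  centred : ∀ i, ∫ ω, (Y i ω - μ i) ∂P = 0
  subgaussian : ∀ i, HasSubgaussianMGF (fun ω => Y i ω - μ i) (Real.toNNReal (σ ^ 2)) P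

section Algorithm

variable {V : Type*} [Fintype V]

/-- The edges of `G` across which `μ` takes two different values. -/
def splitEdges (G : SimpleGraph V) (μ : V → ℝ) : Set (Sym2 V) :=
  {e | e ∈ G.edgeSet ∧ ¬ (Sym2.map μ e).IsDiag}

open Classical in
/-- The weighted `ℓ₀` (Potts) objective
`F_w(μ) = ½ ‖y - μ‖² + lam * ∑_{ {i,j} ∈ E } w(i,j) 1{μ_i ≠ μ_j}`. -/
def pottsObjective (G : SimpleGraph V) (w : Sym2 V → ℝ) (lam : ℝ) (y μ : V → ℝ) : ℝ :=
  (1 / 2) * ∑ i, (y i - μ i) ^ 2 + lam * ∑ e ∈ G.edgeFinset with e ∈ splitEdges G μ, w e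

/-- Vertices of the graph built by `α`-expansion: the terminals `s` and `t`, the original vertices,
and one auxiliary vertex for each edge across which the current vector is not constant. -/
inductive CutVertex (V A : Type*) where
  | s : CutVertex V A
  | t : CutVertex V A
  | node : V → CutVertex V A
  | aux : A → CutVertex V A

open Classical in
/-- The (symmetric) capacities of the `α`-expansion graph for the current vector `μ` and the
candidate value `c`; capacity zero means that there is no edge. -/
def cutCapacity (G : SimpleGraph V) (w : Sym2 V → ℝ) (lam : ℝ) (y μ : V → ℝ) (c : ℝ) :
    CutVertex V (splitEdges G μ) → CutVertex V (splitEdges G μ) → ENNReal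
  | .s, .node i | .node i, .s => ENNReal.ofReal ((y i - c) ^ 2 / 2)
  | .t, .node i | .node i, .t => if μ i = c then ⊤ else ENNReal.ofReal ((y i - μ i) ^ 2 / 2)
  | .node i, .node j =>
      if G.Adj i j ∧ μ i = μ j ∧ μ i ≠ c then ENNReal.ofReal (lam * w s(i, j)) else 0
  | .node i, .aux e | .aux e, .node i =>
      if i ∈ (e : Sym2 V) ∧ μ i ≠ c then ENNReal.ofReal (lam * w e) else 0
  | .t, .aux e | .aux e, .t => ENNReal.ofReal (lam * w e)
  | _, _ => 0

open Classical in
/-- The value of the cut `(S, Sᶜ)`: the total capacity of the edges between `S` and `Sᶜ`. -/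
def cutValue (G : SimpleGraph V) (w : Sym2 V → ℝ) (lam : ℝ) (y μ : V → ℝ) (c : ℝ)
    (S : Set (CutVertex V (splitEdges G μ))) : ENNReal :=
  ∑' u : S, ∑' v : (Sᶜ : Set (CutVertex V (splitEdges G μ))), cutCapacity G w lam y μ c u v

/-- `S` is the source side of a minimum `s`-`t`-cut of the `α`-expansion graph. -/
def IsMinCut (G : SimpleGraph V) (w : Sym2 V → ℝ) (lam : ℝ) (y μ : V → ℝ) (c : ℝ)
    (S : Set (CutVertex V (splitEdges G μ))) : Prop :=
  (.s ∈ S ∧ .t ∉ S) ∧ ∀ S' : Set (CutVertex V (splitEdges G μ)), .s ∈ S' → .t ∉ S' →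
    cutValue G w lam y μ c S ≤ cutValue G w lam y μ c S'

open Classical in
/-- `ν` is an output of the `α`-expansion routine started at `μ` with candidate value `c`: for some
minimum cut, `ν` keeps the value of `μ` on the source side and takes the value `c` elsewhere. -/
def IsAlphaExpansion (G : SimpleGraph V) (w : Sym2 V → ℝ) (lam : ℝ) (y μ : V → ℝ) (c : ℝ)
    (ν : V → ℝ) : Prop :=
  ∃ S, IsMinCut G w lam y μ c S ∧ ν = fun i => if .node i ∈ S then μ i else c

/-- The constant vector with value the average of `y`. -/
def averageVector (y : V → ℝ) : V → ℝ :=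
  fun _ => (∑ i, y i) / Fintype.card V

/-- The candidate values `δℤ ∩ [min y, max y]`. -/
def candidateValues (δ : ℝ) (y : V → ℝ) : Set ℝ :=
  {c | (∃ m : ℤ, c = m * δ) ∧ c ∈ Set.Icc (⨅ i, y i) (⨆ i, y i)}

open Classical in
/-- The body of the loop of the algorithm, on the state `(FLAG, μ₁)`; `F` is the objective, `μ₀`
the initial vector and `ν` the proposal returned by `α`-expansion. -/
def pottsStep (F : (V → ℝ) → ℝ) (τ : ℝ) (μ₀ : V → ℝ) (st : Bool × (V → ℝ)) (ν : V → ℝ) :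
    Bool × (V → ℝ) :=
  if F ν ≤ F μ₀ - τ then (true, if F ν ≤ F st.2 then ν else st.2) else st

/-- `μ` is an output of the one-split Potts algorithm on the data `y`, for some order in which the
candidate values are visited and some choice of the minimum cuts. -/
def IsPottsOutput (G : SimpleGraph V) (y : V → ℝ) (δ τ lam : ℝ) (w : Sym2 V → ℝ)
    (μ : V → ℝ) : Prop :=
  ∃ (cs : List ℝ) (expand : ℝ → V → ℝ),
    cs.Nodup ∧ (∀ c, c ∈ cs ↔ c ∈ candidateValues δ y) ∧
    (∀ c ∈ cs, IsAlphaExpansion G w lam y (averageVector y) c (expand c)) ∧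
    let final := (cs.map expand).foldl
      (pottsStep (pottsObjective G w lam y) τ (averageVector y)) (false, fun _ => 0)
    μ = if final.1 then final.2 else averageVector y

end Algorithm

end

/-! ### Spanning trees -/

section Trees

/-! The proof separates a probabilistic statement about all vertex sets from a deterministic
analysis of the output. Write `L = σ² log W` with `W = w(|E|)`, `u` for the jump, and `d(A)` for the
weight of the cut of `A`.

Noise. With probability at least `1 - 1/W`, the squared noise sum over every proper nonempty `A` is
at most `8 L |A| d(A)` (`NoiseBound`, `measureReal_not_noiseBound_le`). The sub-Gaussian tail at `A`
is `2 W^(-4 d(A))`, so the union bound needs the sum of `W^(-4 d(A))` over exponentially many `A`.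
Since `w ≥ r`, `d(A)` is at least the expected number of cut edges in a uniform spanning tree.
Jensen's inequality moves this average outside the exponential, and in a single tree each edge set
is the cut of at most two vertex sets, so the binomial theorem bounds the sum
(`sum_exp_neg_cutWeight_le`). Foster's theorem, `W ≥ n - 1`, makes the result small.

Algorithm. From a constant vector the expansion graph has no auxiliary vertices, and a cut has
exactly the value of the objective at the two-valued vector it encodes (`cutValue_const`). Hence an
output with new value `c` is optimal among all splits with value `c`, and at least as good as the
true split with a grid value near the average of the data on the smaller part
(`IsPottsOutput.exists_minimizer`).

Geometry. On the noise event, AM-GM bounds each noise term by a small quadratic term plus a multiple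
of `L d(A)`, which the penalty absorbs. Near-optimality of the gain forces `c` close to the signal
on one part `T`, with the overall mean `m` far from it (`close_of_gain_large`). Each misclassified
vertex then loses a fixed multiple of `u²`, so comparing the output with the split along `T` at the
same `c` bounds the symmetric difference by a multiple of `L d(T) / u²`
(`card_sdiff_le_of_splitGain_le`). -/

lemma effectiveResistance_nonneg {V : Type*} (G : SimpleGraph V) (e : Sym2 V) :
    0 ≤ effectiveResistance G e := by
  unfold effectiveResistance; positivity

variable {V : Type*} [Fintype V]

open Classical in
/-- The spanning trees of `G` as a finite set. -/
noncomputable def treeFinset (G : SimpleGraph V) : Finset (SimpleGraph V) :=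
  (Set.toFinite (spanningTrees G)).toFinset

lemma mem_treeFinset {G T : SimpleGraph V} : T ∈ treeFinset G ↔ T ≤ G ∧ T.IsTree := by
  simp [treeFinset, spanningTrees]

end Trees

/-! ### Cuts, their weights, and exponential sums over them -/

section Cuts

variable {V : Type*} [Fintype V] [DecidableEq V]

open Classical in
/-- The edges of `G` with exactly one endpoint in `A`. -/
noncomputable def cutEdges (G : SimpleGraph V) (A : Finset V) : Finset (Sym2 V) :=
  {e ∈ G.edgeFinset | (∃ i ∈ e, i ∈ A) ∧ ∃ j ∈ e, j ∉ A}

/-- The total weight of the edges with exactly one endpoint in `A`. -/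
noncomputable def cutWeight (G : SimpleGraph V) (w : Sym2 V → ℝ) (A : Finset V) : ℝ :=
  ∑ e ∈ cutEdges G A, w e

lemma mk_mem_cutEdges {G : SimpleGraph V} {A : Finset V} {i j : V} :
    s(i, j) ∈ cutEdges G A ↔ G.Adj i j ∧ ¬ (i ∈ A ↔ j ∈ A) := by
  simp only [cutEdges, Finset.mem_filter, SimpleGraph.mem_edgeFinset, SimpleGraph.mem_edgeSet,
    Sym2.mem_iff]
  refine and_congr_right fun _ => ?_
  constructor
  · rintro ⟨⟨k, rfl | rfl, hk⟩, l, rfl | rfl, hl⟩ <;> tauto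
  · intro h
    by_cases hi : i ∈ A
    · exact ⟨⟨i, Or.inl rfl, hi⟩, j, Or.inr rfl, by tauto⟩
    · exact ⟨⟨j, Or.inr rfl, by tauto⟩, i, Or.inl rfl, hi⟩

lemma mem_edgeSet_of_mem_cutEdges {G : SimpleGraph V} {A : Finset V} {e : Sym2 V}
    (h : e ∈ cutEdges G A) : e ∈ G.edgeSet := by
  induction e using Sym2.ind with
  | h i j => exact (mk_mem_cutEdges.1 h).1

lemma cutEdges_compl (G : SimpleGraph V) (A : Finset V) : cutEdges G Aᶜ = cutEdges G A := by
  ext e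
  induction e using Sym2.ind with
  | h i j => simp only [mk_mem_cutEdges, Finset.mem_compl]; tauto

lemma cutEdges_empty (G : SimpleGraph V) : cutEdges G ∅ = ∅ := by
  ext e
  induction e using Sym2.ind with
  | h i j => simp [mk_mem_cutEdges]

lemma cutEdges_univ (G : SimpleGraph V) : cutEdges G Finset.univ = ∅ := by
  ext e
  induction e using Sym2.ind with
  | h i j => simp [mk_mem_cutEdges]

lemma cutEdges_sdiff_subset (G : SimpleGraph V) (A B : Finset V) :
    cutEdges G (A \ B) ⊆ cutEdges G A ∪ cutEdges G B := by
  intro e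
  induction e using Sym2.ind with
  | h i j => simp only [Finset.mem_union, mk_mem_cutEdges, Finset.mem_sdiff]; tauto

open Classical in
lemma cutEdges_of_le {G T : SimpleGraph V} (h : T ≤ G) (A : Finset V) :
    cutEdges T A = {e ∈ cutEdges G A | e ∈ T.edgeSet} := by
  ext e
  induction e using Sym2.ind with
  | h i j =>
    simp only [Finset.mem_filter, mk_mem_cutEdges, SimpleGraph.mem_edgeSet]
    exact ⟨fun ⟨a, b⟩ => ⟨⟨h a, b⟩, a⟩, fun ⟨⟨_, b⟩, a⟩ => ⟨a, b⟩⟩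

/-- In a connected graph a vertex set is determined by its cut and by whether it contains a given
vertex. -/
lemma eq_of_cutEdges_eq {G : SimpleGraph V} (hG : G.Connected) {A B : Finset V} {v : V}
    (hv : v ∈ A ↔ v ∈ B) (h : cutEdges G A = cutEdges G B) : A = B := by
  ext j
  obtain ⟨p⟩ := hG.preconnected v j
  induction p with
  | nil => exact hv
  | @cons a b c hab p ih =>
    refine ih ?_
    have := congrArg (s(a, b) ∈ ·) h
    simp only [mk_mem_cutEdges, hab, true_and, eq_iff_iff] at this
    tauto

lemma cutEdges_nonempty {G : SimpleGraph V} (hG : G.Connected) {A : Finset V}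
    (h0 : A ≠ ∅) (h1 : A ≠ Finset.univ) : (cutEdges G A).Nonempty := by
  by_contra h
  rw [Finset.not_nonempty_iff_eq_empty] at h
  obtain ⟨v⟩ := hG.nonempty
  by_cases hv : v ∈ A
  · exact h1 (eq_of_cutEdges_eq hG (v := v) (by simp [hv]) (h.trans (cutEdges_univ G).symm))
  · exact h0 (eq_of_cutEdges_eq hG (v := v) (by simp [hv]) (h.trans (cutEdges_empty G).symm))

/-- The generating function of the cut sizes of a tree. -/
lemma sum_pow_card_cutEdges_le {T : SimpleGraph V} (hT : T.IsTree) {x : ℝ} (hx : 0 ≤ x) :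
    ∑ A : Finset V, x ^ (cutEdges T A).card ≤ 2 * (1 + x) ^ (Fintype.card V - 1) := by
  classical
  obtain ⟨v⟩ := hT.connected.nonempty
  have hcard : T.edgeFinset.card = Fintype.card V - 1 := by
    have := hT.card_edgeFinset
    omega
  -- The cut together with one bit, the side of `v`, determines the set. Every edge subset of the
  -- tree is thus counted at most twice, whence the factor 2.
  have hinj : Function.Injective
      (fun A : Finset V => ((decide (v ∈ A) : Bool), cutEdges T A)) := by
    intro A B h
    simp only [Prod.mk.injEq, decide_eq_decide] at h
    exact eq_of_cutEdges_eq hT.connected h.1 h.2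
  calc ∑ A : Finset V, x ^ (cutEdges T A).card
      = ∑ p ∈ Finset.univ.image (fun A : Finset V => ((decide (v ∈ A) : Bool), cutEdges T A)),
          x ^ p.2.card := by
        rw [Finset.sum_image (fun a _ b _ h => hinj h)]
    _ ≤ ∑ p ∈ (Finset.univ : Finset Bool) ×ˢ T.edgeFinset.powerset, x ^ p.2.card := by
        refine Finset.sum_le_sum_of_subset_of_nonneg ?_ (fun _ _ _ => pow_nonneg hx _)
        intro p hp
        obtain ⟨A, -, rfl⟩ := Finset.mem_image.1 hp
        simp only [Finset.mem_product, Finset.mem_univ, true_and, Finset.mem_powerset]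
        intro e he
        exact SimpleGraph.mem_edgeFinset.2 (mem_edgeSet_of_mem_cutEdges he)
    _ = 2 * (1 + x) ^ (Fintype.card V - 1) := by
        rw [Finset.sum_product, ← hcard]
        have := Finset.sum_pow_mul_eq_add_pow x 1 T.edgeFinset
        simp only [one_pow, mul_one] at this
        simp [this, add_comm]

open Classical in
/-- The proper nonempty subsets of `V`. -/
noncomputable def properSubsets (V : Type*) [Fintype V] : Finset (Finset V) :=
  {A | A ≠ ∅ ∧ A ≠ Finset.univ}

lemma mem_properSubsets {A : Finset V} :
    A ∈ properSubsets V ↔ A ≠ ∅ ∧ A ≠ Finset.univ := by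
  simp [properSubsets]

/-- The empty and the full set have empty cuts and contribute 1 each. Only after removing them does
the sum vanish as `x → 0`, as the union bound requires. -/
lemma sum_properSubsets_pow_card_cutEdges_le {T : SimpleGraph V} (hT : T.IsTree) {x : ℝ}
    (hx : 0 ≤ x) :
    ∑ A ∈ properSubsets V, x ^ (cutEdges T A).card
      ≤ 2 * ((1 + x) ^ (Fintype.card V - 1) - 1) := by
  classical
  obtain ⟨v⟩ := hT.connected.nonempty
  have h := sum_pow_card_cutEdges_le hT hx
  have hsplit := Finset.sum_filter_add_sum_filter_not (Finset.univ : Finset (Finset V))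
    (fun A => A ≠ ∅ ∧ A ≠ Finset.univ) (fun A => x ^ (cutEdges T A).card)
  have hrest : (Finset.univ.filter fun A : Finset V => ¬ (A ≠ ∅ ∧ A ≠ Finset.univ))
      = {∅, Finset.univ} := by
    ext A; simp; tauto
  have hne : (∅ : Finset V) ≠ Finset.univ := by
    intro h
    have := Finset.mem_univ v
    rw [← h] at this
    simp at this
  rw [hrest, Finset.sum_pair hne, cutEdges_empty, cutEdges_univ] at hsplit
  have hp : properSubsets V = Finset.univ.filter fun A : Finset V => A ≠ ∅ ∧ A ≠ Finset.univ := by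
    ext A; simp [mem_properSubsets]
  rw [hp]
  simp only [Finset.card_empty, pow_zero] at hsplit
  linarith

omit [DecidableEq V] in
lemma treeFinset_card_pos {G : SimpleGraph V} (hG : G.Connected) :
    (0 : ℝ) < (treeFinset G).card := by
  obtain ⟨T, hT, hT'⟩ := hG.exists_isTree_le
  exact_mod_cast Finset.card_pos.2 ⟨T, mem_treeFinset.2 ⟨hT, hT'⟩⟩

omit [DecidableEq V] in
open Classical in
lemma effectiveResistance_eq (G : SimpleGraph V) (e : Sym2 V) :
    effectiveResistance G e
      = (∑ T ∈ treeFinset G, if e ∈ T.edgeSet then (1 : ℝ) else 0) / (treeFinset G).card := by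
  have h1 : (spanningTrees G).ncard = (treeFinset G).card :=
    Set.ncard_eq_toFinset_card _ _
  have h2 : {T | T ∈ spanningTrees G ∧ e ∈ T.edgeSet}
      = ((treeFinset G).filter fun T => e ∈ T.edgeSet : Finset (SimpleGraph V)) := by
    ext T; simp [mem_treeFinset, spanningTrees]
  rw [effectiveResistance, h1, h2, Set.ncard_coe_finset, Finset.sum_boole]

omit [DecidableEq V] in
open Classical in
lemma sum_effectiveResistance (G : SimpleGraph V) (D : Finset (Sym2 V)) :
    ∑ e ∈ D, effectiveResistance G e
      = (∑ T ∈ treeFinset G, (({e ∈ D | e ∈ T.edgeSet} : Finset (Sym2 V)).card : ℝ))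
          / (treeFinset G).card := by
  simp only [effectiveResistance_eq, ← Finset.sum_div]
  rw [Finset.sum_comm]
  simp only [Finset.sum_boole]

omit [DecidableEq V] in
/-- **Foster's theorem** gives a lower bound for the total weight. -/
lemma card_sub_one_le_totalWeight {G : SimpleGraph V} (hG : G.Connected) {w : Sym2 V → ℝ}
    (hw : ∀ e ∈ G.edgeSet, effectiveResistance G e ≤ w e) :
    (Fintype.card V : ℝ) - 1 ≤ totalWeight G w := by
  classical
  have hpos := treeFinset_card_pos hG
  have h1 : ∑ e ∈ G.edgeFinset, effectiveResistance G e ≤ totalWeight G w := by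
    unfold totalWeight
    convert Finset.sum_le_sum fun e he => hw e (SimpleGraph.mem_edgeFinset.1 he) using 2
  refine le_trans ?_ h1
  rw [sum_effectiveResistance, le_div_iff₀ hpos, mul_comm, ← nsmul_eq_mul]
  refine Finset.card_nsmul_le_sum _ _ _ fun T hT => ?_
  obtain ⟨hTG, hT⟩ := mem_treeFinset.1 hT
  have h2 : G.edgeFinset.filter (fun e => e ∈ T.edgeSet) = T.edgeFinset := by
    ext e
    simp only [Finset.mem_filter, SimpleGraph.mem_edgeFinset]
    exact ⟨fun h => h.2, fun h => ⟨SimpleGraph.edgeSet_mono hTG h, h⟩⟩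
  have h3 := hT.card_edgeFinset
  have h4 : (T.edgeFinset.card : ℝ) + 1 = Fintype.card V := by exact_mod_cast h3
  rw [h2]; linarith

/-- Summing effective resistances over a cut gives, by linearity, the mean number of cut edges in a
uniform spanning tree. -/
lemma average_card_cutEdges_le_cutWeight {G : SimpleGraph V} {w : Sym2 V → ℝ}
    (hw : ∀ e ∈ G.edgeSet, effectiveResistance G e ≤ w e) (A : Finset V) :
    (∑ T ∈ treeFinset G, ((cutEdges T A).card : ℝ)) / (treeFinset G).card ≤ cutWeight G w A := by
  classical
  have h := Finset.sum_le_sum (s := cutEdges G A)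
    fun e he => hw e (mem_edgeSet_of_mem_cutEdges he)
  rw [sum_effectiveResistance] at h
  refine le_trans (le_of_eq ?_) h
  congr 1
  refine Finset.sum_congr rfl fun T hT => ?_
  rw [cutEdges_of_le (mem_treeFinset.1 hT).1]

/-- Every spanning tree is connected, hence crosses the cut at least once, and so does the average.
-/
lemma one_le_cutWeight {G : SimpleGraph V} (hG : G.Connected) {w : Sym2 V → ℝ}
    (hw : ∀ e ∈ G.edgeSet, effectiveResistance G e ≤ w e) {A : Finset V}
    (h0 : A ≠ ∅) (h1 : A ≠ Finset.univ) : 1 ≤ cutWeight G w A := by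
  refine le_trans ?_ (average_card_cutEdges_le_cutWeight hw A)
  rw [le_div_iff₀ (treeFinset_card_pos hG), one_mul, ← mul_one ((treeFinset G).card : ℝ),
    ← nsmul_eq_mul]
  refine Finset.card_nsmul_le_sum _ _ _ fun T hT => ?_
  exact_mod_cast Finset.card_pos.2 (cutEdges_nonempty (mem_treeFinset.1 hT).2.connected h0 h1)

section Weights

variable {G : SimpleGraph V} {w : Sym2 V → ℝ}

lemma cutWeight_compl (A : Finset V) : cutWeight G w Aᶜ = cutWeight G w A := by
  simp only [cutWeight, cutEdges_compl]

lemma cutWeight_univ : cutWeight G w Finset.univ = 0 := by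
  simp [cutWeight, cutEdges_univ]

lemma cutWeight_empty : cutWeight G w ∅ = 0 := by
  simp [cutWeight, cutEdges_empty]

lemma cutWeight_nonneg (hw : ∀ e ∈ G.edgeSet, 0 ≤ w e) (A : Finset V) : 0 ≤ cutWeight G w A :=
  Finset.sum_nonneg fun e he => hw e (mem_edgeSet_of_mem_cutEdges he)

lemma cutWeight_sdiff_le (hw : ∀ e ∈ G.edgeSet, 0 ≤ w e) (A B : Finset V) :
    cutWeight G w (A \ B) ≤ cutWeight G w A + cutWeight G w B := by
  have hmem : ∀ e ∈ cutEdges G A ∪ cutEdges G B, 0 ≤ w e := by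
    intro e he
    rcases Finset.mem_union.1 he with h | h <;> exact hw e (mem_edgeSet_of_mem_cutEdges h)
  have hi := Finset.sum_union_inter (s₁ := cutEdges G A) (s₂ := cutEdges G B) (f := w)
  have h1 : cutWeight G w (A \ B) ≤ ∑ e ∈ cutEdges G A ∪ cutEdges G B, w e :=
    Finset.sum_le_sum_of_subset_of_nonneg (cutEdges_sdiff_subset G A B) fun e he _ => hmem e he
  have h2 : 0 ≤ ∑ e ∈ cutEdges G A ∩ cutEdges G B, w e :=
    Finset.sum_nonneg fun e he => hmem e (Finset.mem_union_left _ (Finset.mem_inter.1 he).1)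
  unfold cutWeight at *
  linarith

end Weights

/-- Exponential sums over cuts, bounded by averaging over spanning trees. -/
lemma sum_exp_neg_cutWeight_le {G : SimpleGraph V} (hG : G.Connected) {w : Sym2 V → ℝ}
    (hw : ∀ e ∈ G.edgeSet, effectiveResistance G e ≤ w e) {s : ℝ} (hs : 0 ≤ s) :
    ∑ A ∈ properSubsets V, Real.exp (-(s * cutWeight G w A))
      ≤ 2 * ((1 + Real.exp (-s)) ^ (Fintype.card V - 1) - 1) := by
  have hpos := treeFinset_card_pos hG
  set N : ℝ := ((treeFinset G).card : ℝ) with hN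
  have hA : ∀ A : Finset V, Real.exp (-(s * cutWeight G w A))
      ≤ ∑ T ∈ treeFinset G, N⁻¹ * Real.exp (-s) ^ (cutEdges T A).card := by
    intro A
    have h1 : Real.exp (-(s * cutWeight G w A))
        ≤ Real.exp (∑ T ∈ treeFinset G, N⁻¹ • (-s * (cutEdges T A).card)) := by
      refine Real.exp_le_exp.2 ?_
      have := mul_le_mul_of_nonneg_left (average_card_cutEdges_le_cutWeight hw A) hs
      have h2 : ∑ T ∈ treeFinset G, N⁻¹ • (-s * ((cutEdges T A).card : ℝ))
          = - (s * ((∑ T ∈ treeFinset G, ((cutEdges T A).card : ℝ)) / (treeFinset G).card)) := by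
        simp only [smul_eq_mul]
        rw [← Finset.mul_sum, ← Finset.mul_sum, ← hN]
        ring
      rw [h2]; linarith
    -- Jensen's inequality for the uniform distribution on the spanning trees.
    refine h1.trans ((convexOn_exp.map_sum_le (fun _ _ => by positivity) ?_
      (fun _ _ => Set.mem_univ _)).trans (le_of_eq ?_))
    · rw [Finset.sum_const, nsmul_eq_mul, ← hN, mul_inv_cancel₀ hpos.ne']
    · refine Finset.sum_congr rfl fun T _ => ?_
      rw [smul_eq_mul, ← Real.exp_nat_mul, mul_comm (-s)]
  refine (Finset.sum_le_sum fun A _ => hA A).trans ?_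
  rw [Finset.sum_comm]
  have hT : ∀ T ∈ treeFinset G,
      ∑ A ∈ properSubsets V, N⁻¹ * Real.exp (-s) ^ (cutEdges T A).card
        ≤ N⁻¹ * (2 * ((1 + Real.exp (-s)) ^ (Fintype.card V - 1) - 1)) := by
    intro T hT
    rw [← Finset.mul_sum]
    exact mul_le_mul_of_nonneg_left (sum_properSubsets_pow_card_cutEdges_le
      (mem_treeFinset.1 hT).2 (Real.exp_pos _).le) (by positivity)
  refine (Finset.sum_le_sum hT).trans (le_of_eq ?_)
  rw [Finset.sum_const, nsmul_eq_mul, ← hN, ← mul_assoc, mul_inv_cancel₀ hpos.ne', one_mul]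

end Cuts

/-! ### α-expansion of a constant vector -/

section Expansion

variable {V : Type*} [Fintype V] [DecidableEq V]

/-- The vector that equals `c` on `A` and `m` elsewhere. -/
def twoValued (A : Finset V) (c m : ℝ) : V → ℝ := fun i => if i ∈ A then c else m

omit [Fintype V] [DecidableEq V] in
lemma splitEdges_const (G : SimpleGraph V) (m : ℝ) : splitEdges G (fun _ => m) = ∅ := by
  ext e
  induction e using Sym2.ind with
  | h i j => simp [splitEdges]

lemma mem_splitEdges_twoValued {G : SimpleGraph V} {A : Finset V} {c m : ℝ} (h : c ≠ m)
    (e : Sym2 V) : e ∈ splitEdges G (twoValued A c m) ↔ e ∈ cutEdges G A := by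
  induction e using Sym2.ind with
  | h i j =>
    simp only [splitEdges, Set.mem_ofPred_eq, SimpleGraph.mem_edgeSet, Sym2.map_mk,
      Sym2.mk_isDiag_iff, mk_mem_cutEdges, twoValued]
    refine and_congr_right fun _ => ?_
    by_cases hi : i ∈ A <;> by_cases hj : j ∈ A <;> simp [hi, hj, h, h.symm]

omit [DecidableEq V] in
lemma pottsObjective_const (G : SimpleGraph V) (w : Sym2 V → ℝ) (lam : ℝ) (y : V → ℝ) (m : ℝ) :
    pottsObjective G w lam y (fun _ => m) = (1 / 2) * ∑ i, (y i - m) ^ 2 := by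
  simp [pottsObjective, splitEdges_const]

lemma pottsObjective_twoValued (G : SimpleGraph V) (w : Sym2 V → ℝ) (lam : ℝ) (y : V → ℝ)
    (A : Finset V) {c m : ℝ} (h : c ≠ m) :
    pottsObjective G w lam y (twoValued A c m)
      = (1 / 2) * (∑ i ∈ A, (y i - c) ^ 2 + ∑ i ∈ Aᶜ, (y i - m) ^ 2)
        + lam * cutWeight G w A := by
  classical
  unfold pottsObjective cutWeight
  congr 2
  · rw [← Finset.sum_add_sum_compl A]
    congr 1
    · exact Finset.sum_congr rfl fun i hi => by simp [twoValued, hi]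
    · exact Finset.sum_congr rfl fun i hi => by simp [twoValued, Finset.mem_compl.1 hi]
  · refine Finset.sum_congr ?_ fun _ _ => rfl
    ext e
    simp only [Finset.mem_filter, SimpleGraph.mem_edgeFinset, mem_splitEdges_twoValued h]
    exact ⟨fun h => h.2, fun h => ⟨mem_edgeSet_of_mem_cutEdges h, h⟩⟩

omit [DecidableEq V] in
lemma tsum_cutVertex {B : Type*} [IsEmpty B] (g : CutVertex V B → ENNReal) :
    ∑' u, g u = g .s + g .t + ∑ i, g (.node i) := by
  let φ : CutVertex V B ≃ Option (Option V) :=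
    { toFun := fun u => match u with
        | .s => none
        | .t => some none
        | .node i => some (some i)
        | .aux a => isEmptyElim a
      invFun := fun u => match u with
        | none => .s
        | some none => .t
        | some (some i) => .node i
      left_inv := by rintro (_ | _ | _ | a) <;> first | rfl | exact isEmptyElim a
      right_inv := by rintro (_ | _ | _) <;> rfl }
  rw [← φ.symm.tsum_eq, tsum_fintype, Fintype.sum_option, Fintype.sum_option, add_assoc]
  rfl

lemma sum_adj_eq_cutWeight (G : SimpleGraph V) [DecidableRel G.Adj] (w : Sym2 V → ℝ)
    (A : Finset V) :
    ∑ i ∈ A, ∑ j ∈ Aᶜ, (if G.Adj i j then w s(i, j) else 0) = cutWeight G w A := by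
  rw [← Finset.sum_product', ← Finset.sum_filter, cutWeight]
  refine Finset.sum_bij (fun p _ => s(p.1, p.2)) ?_ ?_ ?_ ?_
  · rintro ⟨i, j⟩ h
    simp only [Finset.mem_filter, Finset.mem_product, Finset.mem_compl] at h
    exact mk_mem_cutEdges.2 ⟨h.2, by tauto⟩
  · rintro ⟨i, j⟩ h ⟨k, l⟩ h' he
    simp only [Finset.mem_filter, Finset.mem_product, Finset.mem_compl] at h h'
    rcases Sym2.eq_iff.1 he with ⟨rfl, rfl⟩ | ⟨rfl, rfl⟩
    · rfl
    · exact absurd h.1.1 h'.1.2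
  · intro e he
    induction e using Sym2.ind with
    | h i j =>
      obtain ⟨hadj, hij⟩ := mk_mem_cutEdges.1 he
      by_cases hi : i ∈ A
      · exact ⟨(i, j), by simp [hi, hadj]; tauto, rfl⟩
      · exact ⟨(j, i), by simp [hi, hadj.symm]; tauto, Sym2.eq_swap⟩
  · intros; rfl

/-- The source side of the cut that moves exactly the vertices of `A` to the new value. -/
def cutOf {B : Type*} (A : Finset V) : Set (CutVertex V B) :=
  {u | u = .s ∨ ∃ i, i ∉ A ∧ u = .node i}

-- For a constant vector no edge is split, so there are no auxiliary vertices, and `c ≠ m` excludes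
-- the infinite capacities. Source links cut at `A` pay the loss for `c`, sink links cut off `A` pay
-- the loss for `m`, and cut graph edges pay the penalty.
open Classical in
lemma cutValue_const {G : SimpleGraph V} {w : Sym2 V → ℝ} {lam : ℝ} (y : V → ℝ) {m c : ℝ}
    (hw : ∀ e ∈ G.edgeSet, 0 ≤ w e) (hlam : 0 ≤ lam) (hmc : c ≠ m)
    (S : Set (CutVertex V (splitEdges G (fun _ : V => m)))) (hs : .s ∈ S) (ht : .t ∉ S)
    (A : Finset V) (hA : ∀ i, i ∈ A ↔ .node i ∉ S) :
    cutValue G w lam y (fun _ => m) c S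
      = ENNReal.ofReal (pottsObjective G w lam y (twoValued A c m)) := by
  have : IsEmpty (splitEdges G (fun _ : V => m)) := by
    rw [splitEdges_const]; infer_instance
  have hA' : ∀ i, .node i ∈ S ↔ i ∈ Aᶜ := by
    intro i; rw [Finset.mem_compl, hA, not_not]
  have hind : cutValue G w lam y (fun _ => m) c S
      = ∑' u, ∑' v, if u ∈ S ∧ v ∉ S then cutCapacity G w lam y (fun _ => m) c u v else 0 := by
    unfold cutValue
    rw [tsum_subtype S (fun u => ∑' v : (Sᶜ : Set _), cutCapacity G w lam y (fun _ => m) c u v)]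
    refine tsum_congr fun u => ?_
    by_cases hu : u ∈ S
    · rw [Set.indicator_of_mem hu,
        tsum_subtype Sᶜ (fun v => cutCapacity G w lam y (fun _ => m) c u v)]
      refine tsum_congr fun v => ?_
      by_cases hv : v ∈ S <;> simp [hu, hv]
    · simp [hu]
  rw [hind, tsum_cutVertex]
  simp only [tsum_cutVertex, hs, ht, hA', cutCapacity, Finset.mem_compl, not_not, true_and,
    not_true_eq_false, false_and, and_false, if_false, not_false_eq_true, if_true, hmc.symm,
    and_true, ne_eq, zero_add, Finset.sum_const_zero, add_zero]
  have hedge : ∀ i j, (if G.Adj i j then ENNReal.ofReal (lam * w s(i, j)) else 0)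
      = ENNReal.ofReal (lam * if G.Adj i j then w s(i, j) else 0) := by
    intro i j; split_ifs <;> simp
  have hnn : ∀ i j, 0 ≤ lam * (if G.Adj i j then w s(i, j) else 0) := by
    intro i j
    refine mul_nonneg hlam ?_
    split_ifs with h
    · exact hw _ h
    · exact le_rfl
  have hval : ∑ i ∈ Aᶜ, ∑ j ∈ A, lam * (if G.Adj i j then w s(i, j) else 0)
      = lam * cutWeight G w A := by
    simp only [← Finset.mul_sum]
    rw [← cutWeight_compl, ← sum_adj_eq_cutWeight G w Aᶜ, compl_compl]
  rw [pottsObjective_twoValued G w lam y A hmc, ← hval]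
  have e1 : (∑ i, if i ∈ A then ENNReal.ofReal ((y i - c) ^ 2 / 2) else 0)
      = ENNReal.ofReal (∑ i ∈ A, (y i - c) ^ 2 / 2) := by
    rw [ENNReal.ofReal_sum_of_nonneg (fun _ _ => by positivity), ← Finset.sum_filter]
    simp
  have e2 : (∑ i, ((if i ∉ A then ENNReal.ofReal ((y i - m) ^ 2 / 2) else 0)
        + ∑ j, if i ∉ A ∧ j ∈ A then (if G.Adj i j then ENNReal.ofReal (lam * w s(i, j)) else 0)
            else 0))
      = ENNReal.ofReal (∑ i ∈ Aᶜ, ((y i - m) ^ 2 / 2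
          + ∑ j ∈ A, lam * (if G.Adj i j then w s(i, j) else 0))) := by
    rw [ENNReal.ofReal_sum_of_nonneg (fun i _ => add_nonneg (by positivity)
      (Finset.sum_nonneg fun j _ => hnn i j)), ← Finset.sum_filter_add_sum_filter_not _ (· ∈ A)]
    rw [Finset.sum_eq_zero (s := Finset.univ.filter (· ∈ A)), zero_add]
    · refine Finset.sum_congr (by ext; simp) fun i hi => ?_
      have hi' := Finset.mem_compl.1 hi
      rw [ENNReal.ofReal_add (by positivity) (Finset.sum_nonneg fun j _ => hnn i j),
        ENNReal.ofReal_sum_of_nonneg fun j _ => hnn i j]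
      simp only [hi', not_false_eq_true, if_true, true_and, hedge]
      rw [← Finset.sum_filter]
      simp
    · intro i hi
      simp at hi
      simp [hi]
  have e3 := ENNReal.ofReal_add (p := ∑ i ∈ A, (y i - c) ^ 2 / 2)
    (q := ∑ i ∈ Aᶜ, ((y i - m) ^ 2 / 2
          + ∑ j ∈ A, lam * (if G.Adj i j then w s(i, j) else 0)))
    (Finset.sum_nonneg fun _ _ => by positivity)
    (Finset.sum_nonneg fun i _ => add_nonneg (by positivity)
      (Finset.sum_nonneg fun j _ => hnn i j))
  have e4 : (1 / 2) * (∑ i ∈ A, (y i - c) ^ 2 + ∑ i ∈ Aᶜ, (y i - m) ^ 2)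
        + ∑ i ∈ Aᶜ, ∑ j ∈ A, lam * (if G.Adj i j then w s(i, j) else 0)
      = ∑ i ∈ A, (y i - c) ^ 2 / 2 + ∑ i ∈ Aᶜ, ((y i - m) ^ 2 / 2
          + ∑ j ∈ A, lam * (if G.Adj i j then w s(i, j) else 0)) := by
    rw [Finset.sum_add_distrib, ← Finset.sum_div, ← Finset.sum_div]
    ring
  rw [e4, e3, ← e1, ← e2]

omit [DecidableEq V] in
lemma pottsObjective_nonneg {G : SimpleGraph V} {w : Sym2 V → ℝ} {lam : ℝ} (y v : V → ℝ)
    (hw : ∀ e ∈ G.edgeSet, 0 ≤ w e) (hlam : 0 ≤ lam) : 0 ≤ pottsObjective G w lam y v := by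
  classical
  unfold pottsObjective
  refine add_nonneg (by positivity) (mul_nonneg hlam (Finset.sum_nonneg fun e he => hw e ?_))
  exact SimpleGraph.mem_edgeFinset.1 (Finset.mem_filter.1 he).1

/-- The `α`-expansion of a constant vector is a minimizer of the objective among the vectors with
two given values. -/
lemma IsAlphaExpansion.exists_twoValued {G : SimpleGraph V} {w : Sym2 V → ℝ} {lam : ℝ}
    {y ν : V → ℝ} {m c : ℝ} (hw : ∀ e ∈ G.edgeSet, 0 ≤ w e) (hlam : 0 ≤ lam)
    (h : IsAlphaExpansion G w lam y (fun _ => m) c ν) (hmc : c ≠ m) :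
    ∃ A : Finset V, ν = twoValued A c m ∧ ∀ B : Finset V,
      pottsObjective G w lam y ν ≤ pottsObjective G w lam y (twoValued B c m) := by
  classical
  obtain ⟨S, ⟨⟨hs, ht⟩, hmin⟩, rfl⟩ := h
  let A : Finset V := {i | .node i ∉ S}
  have hA : ∀ i, i ∈ A ↔ .node i ∉ S := by simp [A]
  have hν : (fun i => if .node i ∈ S then m else c) = twoValued A c m := by
    funext i
    by_cases hi : CutVertex.node i ∈ S <;> simp [twoValued, hA, hi]
  refine ⟨A, hν, fun B => ?_⟩
  have := hmin (cutOf B) (Or.inl rfl) (by simp [cutOf])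
  rw [cutValue_const y hw hlam hmc S hs ht A hA, cutValue_const y hw hlam hmc (cutOf B) (Or.inl rfl)
    (by simp [cutOf]) B (by simp [cutOf])] at this
  rw [hν]
  exact (ENNReal.ofReal_le_ofReal_iff (pottsObjective_nonneg y _ hw hlam)).1 this

omit [Fintype V] [DecidableEq V] in
lemma IsAlphaExpansion.eq_const {G : SimpleGraph V} {w : Sym2 V → ℝ} {lam : ℝ}
    {y ν : V → ℝ} {m : ℝ} (h : IsAlphaExpansion G w lam y (fun _ => m) m ν) :
    ν = fun _ => m := by
  obtain ⟨S, -, rfl⟩ := h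
  simp

end Expansion

/-! ### The loop over candidate values -/

section Loop

variable {V : Type*}

/-- The loop keeps the best among the proposals that pass the threshold. -/
lemma foldl_pottsStep (F : (V → ℝ) → ℝ) {τ : ℝ} (hτ : 0 ≤ τ) (μ₀ v₀ : V → ℝ) (h₀ : F μ₀ ≤ F v₀)
    (l : List (V → ℝ)) :
    let st := l.foldl (pottsStep F τ μ₀) (false, v₀)
    (st = (false, v₀) ∧ ∀ ν ∈ l, ¬ F ν ≤ F μ₀ - τ) ∨
      (st.1 = true ∧ st.2 ∈ l ∧ F st.2 ≤ F μ₀ - τ ∧ ∀ ν ∈ l, F st.2 ≤ F ν) := by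
  induction l using List.reverseRecOn with
  | nil => simp
  | append_singleton l ν ih =>
    simp only [List.foldl_append, List.foldl_cons, List.foldl_nil, List.mem_append,
      List.mem_singleton]
    rcases ih with ⟨h1, h2⟩ | ⟨h1, h2, h3, h4⟩
    · rw [h1]
      by_cases hν : F ν ≤ F μ₀ - τ
      -- The first proposal that passes always replaces the initial `v₀`, because `F v₀` is at least
      -- `F μ₀`. Earlier proposals failed the threshold, so they are worse.
      · have hν' : F ν ≤ F v₀ := by linarith
        right
        simp only [pottsStep, hν, hν', if_true, true_and, or_true]
        rintro v (hv | rfl)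
        · exact hν.trans (not_le.1 (h2 v hv)).le
        · exact le_rfl
      · left
        simp only [pottsStep, hν, if_false, true_and]
        rintro v (hv | rfl)
        · exact h2 v hv
        · exact hν
    · right
      set st := l.foldl (pottsStep F τ μ₀) (false, v₀)
      by_cases hν : F ν ≤ F μ₀ - τ
      · by_cases hν' : F ν ≤ F st.2
        · simp only [pottsStep, hν, hν', if_true, true_and, or_true]
          rintro v (hv | rfl)
          · exact hν'.trans (h4 v hv)
          · exact le_rfl
        · simp only [pottsStep, hν, hν', if_true, if_false, true_and]
          refine ⟨Or.inl h2, h3, ?_⟩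
          rintro v (hv | rfl)
          · exact h4 v hv
          · exact (not_le.1 hν').le
      · simp only [pottsStep, hν, if_false]
        refine ⟨h1, Or.inl h2, h3, ?_⟩
        rintro v (hv | rfl)
        · exact h4 v hv
        · exact h3.trans (not_le.1 hν).le

end Loop

/-! ### Outputs as minimizers over two-valued vectors -/

section Output

variable {V : Type*} [Fintype V] [DecidableEq V] [Nonempty V]

omit [DecidableEq V] in
lemma sum_sq_sub_average_le (y : V → ℝ) (c : ℝ) :
    ∑ i, (y i - (∑ i, y i) / Fintype.card V) ^ 2 ≤ ∑ i, (y i - c) ^ 2 := by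
  have hn : (Fintype.card V : ℝ) ≠ 0 := by exact_mod_cast Fintype.card_ne_zero
  set m := (∑ i, y i) / Fintype.card V with hm
  have hsum : ∑ i, (y i - m) = 0 := by
    rw [Finset.sum_sub_distrib, Finset.sum_const, nsmul_eq_mul, Finset.card_univ, hm]
    field_simp; ring
  have : ∑ i, (y i - c) ^ 2
      = ∑ i, (y i - m) ^ 2 + 2 * (m - c) * ∑ i, (y i - m) + ∑ _i : V, (m - c) ^ 2 := by
    rw [Finset.mul_sum, ← Finset.sum_add_distrib, ← Finset.sum_add_distrib]
    exact Finset.sum_congr rfl fun i _ => by ring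
  rw [this, hsum]
  have : 0 ≤ ∑ _i : V, (m - c) ^ 2 := Finset.sum_nonneg fun _ _ => sq_nonneg _
  linarith

/-- If some two-valued vector with an admissible value passes the threshold, then every output of
the algorithm minimizes the objective among all of these. -/
lemma IsPottsOutput.exists_minimizer {G : SimpleGraph V} {w : Sym2 V → ℝ} {lam δ τ : ℝ}
    {y μhat : V → ℝ} (hw : ∀ e ∈ G.edgeSet, 0 ≤ w e) (hlam : 0 ≤ lam) (hτ : 0 ≤ τ)
    (h : IsPottsOutput G y δ τ lam w μhat) {m : ℝ} (hm : m = (∑ i, y i) / Fintype.card V)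
    {c₀ : ℝ} (hc₀ : c₀ ∈ candidateValues δ y) {S : Finset V}
    (hgain : pottsObjective G w lam y (twoValued S c₀ m)
      < pottsObjective G w lam y (fun _ => m) - τ) :
    ∃ (A : Finset V) (c : ℝ), c ≠ m ∧ μhat = twoValued A c m ∧
      (∀ B : Finset V,
        pottsObjective G w lam y μhat ≤ pottsObjective G w lam y (twoValued B c m)) ∧
      pottsObjective G w lam y μhat ≤ pottsObjective G w lam y (twoValued S c₀ m) := by
  obtain ⟨cs, expand, -, hcs, hexp, hout⟩ := h
  have havg : averageVector y = fun _ => m := by rw [hm]; rfl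
  rw [havg] at hexp hout
  set F := pottsObjective G w lam y with hF
  -- The mean is the best constant, so the initial zero vector cannot beat it.
  have hbase : F (fun _ => m) ≤ F (fun _ => 0) := by
    rw [hF, pottsObjective_const, pottsObjective_const, hm]
    have := sum_sq_sub_average_le y 0
    linarith
  have hfold := foldl_pottsStep F hτ (fun _ => m) (fun _ => 0) hbase (cs.map expand)
  have hc₀' := (hcs c₀).2 hc₀
  have hc₀m : c₀ ≠ m := by
    rintro rfl
    have : twoValued S c₀ c₀ = fun _ => c₀ := by funext i; simp [twoValued]
    rw [this] at hgain
    linarith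
  obtain ⟨A₀, -, hA₀⟩ := (hexp c₀ hc₀').exists_twoValued hw hlam hc₀m
  have hle₀ : F (expand c₀) ≤ F (twoValued S c₀ m) := hA₀ S
  have hmem₀ : expand c₀ ∈ cs.map expand := List.mem_map_of_mem hc₀'
  dsimp only at hout hfold
  rcases hfold with ⟨-, h2⟩ | ⟨h1, h2, h3, h4⟩
  · exact absurd (hle₀.trans hgain.le) (h2 _ hmem₀)
  · rw [h1, if_pos rfl] at hout
    rw [← hout] at h2 h3 h4
    obtain ⟨c, hc, hce⟩ := List.mem_map.1 h2
    have hlast : F μhat ≤ F (twoValued S c₀ m) := (h4 _ hmem₀).trans hle₀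
    -- With `c = m` the proposal would be the constant vector itself, contradicting the strict gain.
    have hcm : c ≠ m := by
      rintro rfl
      rw [(hexp c hc).eq_const] at hce
      rw [← hce] at hlast
      linarith
    obtain ⟨A, hA, hmin⟩ := (hexp c hc).exists_twoValued hw hlam hcm
    exact ⟨A, c, hcm, hce ▸ hA, hce ▸ hmin, hlast⟩

end Output

/-- A grid of mesh `δ` meets an interval of length at least `δ` near each of its points. -/
lemma exists_int_mul_mem_Icc {δ a b x : ℝ} (hδ : 0 < δ) (hab : δ ≤ b - a) (hx : x ∈ Set.Icc a b) :
    ∃ k : ℤ, (k : ℝ) * δ ∈ Set.Icc a b ∧ |k * δ - x| ≤ δ := by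
  obtain ⟨h1, h2⟩ := hx
  -- Round `x` down if this stays in the interval. Otherwise `x` lies within `δ` of `a`, and
  -- rounding `a` up gives a point of `[a, a + δ)`.
  by_cases h : a ≤ x - δ
  · have e1 := (le_div_iff₀ hδ).1 (Int.floor_le (x / δ))
    have e2 := (div_lt_iff₀ hδ).1 (Int.lt_floor_add_one (x / δ))
    refine ⟨⌊x / δ⌋, ⟨by linarith, by linarith⟩, abs_le.2 ⟨by linarith, by linarith⟩⟩
  · push Not at h
    have e1 := (div_le_iff₀ hδ).1 (Int.le_ceil (a / δ))
    have e2 := (lt_div_iff₀ hδ).1 (by linarith [Int.ceil_lt_add_one (a / δ)] :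
      (⌈a / δ⌉ : ℝ) - 1 < a / δ)
    refine ⟨⌈a / δ⌉, ⟨by linarith, by linarith⟩, abs_le.2 ⟨by linarith, by linarith⟩⟩

/-! ### Gain of a split in the quadratic loss -/

section Gain

variable {V : Type*}

/-- Twice the decrease of the quadratic loss when the value on `A` is changed from `m` to `c`. -/
noncomputable def splitGain (y : V → ℝ) (A : Finset V) (c m : ℝ) : ℝ :=
  ∑ i ∈ A, (c - m) * (2 * (y i - m) - (c - m))

/-- Completing the square around the average `M` on `A`: the gain is largest at `c = M`, and it is
never positive when `M = m`. -/
lemma splitGain_eq_average (y : V → ℝ) {A : Finset V} {c m M : ℝ}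
    (hM : ∑ i ∈ A, y i = A.card * M) :
    splitGain y A c m = A.card * ((M - m) ^ 2 - (c - M) ^ 2) := by
  have : splitGain y A c m
      = 2 * (c - m) * ∑ i ∈ A, y i - ∑ _i ∈ A, ((c - m) * (c + m)) := by
    rw [splitGain, Finset.mul_sum, ← Finset.sum_sub_distrib]
    exact Finset.sum_congr rfl fun i _ => by ring
  rw [this, hM, Finset.sum_const, nsmul_eq_mul]
  ring

lemma splitGain_add (g ε : V → ℝ) (A : Finset V) (c m : ℝ) :
    splitGain (fun i => g i + ε i) A c m
      = ∑ i ∈ A, (c - m) * (2 * (g i - m) - (c - m)) + 2 * (c - m) * ∑ i ∈ A, ε i := by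
  rw [splitGain, Finset.mul_sum, ← Finset.sum_add_distrib]
  exact Finset.sum_congr rfl fun i _ => by ring

lemma pottsObjective_twoValued_eq [Fintype V] [DecidableEq V] (G : SimpleGraph V)
    (w : Sym2 V → ℝ) (lam : ℝ) (y : V → ℝ) (A : Finset V) {c m : ℝ} (h : c ≠ m) :
    pottsObjective G w lam y (twoValued A c m)
      = pottsObjective G w lam y (fun _ => m) - splitGain y A c m / 2 + lam * cutWeight G w A := by
  rw [pottsObjective_twoValued G w lam y A h, pottsObjective_const,
    ← Finset.sum_add_sum_compl A fun i => (y i - m) ^ 2]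
  have : splitGain y A c m = ∑ i ∈ A, (y i - m) ^ 2 - ∑ i ∈ A, (y i - c) ^ 2 := by
    rw [splitGain, ← Finset.sum_sub_distrib]
    exact Finset.sum_congr rfl fun i _ => by ring
  rw [this]; ring

end Gain

/-- If the gain of a split is almost maximal, then the new value is close to the signal on one part
and the old value is far from it. All quantities are divided by the jump. -/
lemma close_of_gain_large {D R q q₁ β ζ : ℝ} (hD : 0 < D) (hDR : D ≤ R) (hR : R * q = D * q₁)
    (hq₁ : 1 / 2 ≤ q₁) (hq₁' : q₁ ≤ 1) (hq : 0 ≤ q) (hqq : q ≤ q₁) (hζ : |ζ| ≤ 1 / 10000)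
    (hRζ : R * ζ ^ 2 ≤ (1 / 10000) ^ 2 * D)
    (h : D * (q₁ ^ 2 - 8 / 10000) ≤ R * (2 * β * (q - ζ) - 998 / 1000 * β ^ 2)) :
    2 / 5 ≤ q ∧ |β - q| ≤ 8 / 100 := by
  have ⟨hζ1, hζ2⟩ := abs_le.1 hζ
  -- Up to scaling, `v` is the distance of `β` from the maximizer of the concave quadratic in `h`.
  -- Since `R q = D q₁`, the maximum is about `D q₁ q`, against a required `D q₁²`: this forces both
  -- `q ≈ q₁` and `v ≈ 0`.
  set v := 998 / 1000 * β - (q - ζ) with hv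
  have e1 : R * v ^ 2 ≤ R * (q - ζ) ^ 2 - 998 / 1000 * (D * (q₁ ^ 2 - 8 / 10000)) := by
    have : 998 / 1000 * (R * (2 * β * (q - ζ) - 998 / 1000 * β ^ 2))
        = R * (q - ζ) ^ 2 - R * v ^ 2 := by rw [hv]; ring
    linarith
  have e2 : R * (q - ζ) ^ 2 ≤ D * (q₁ * q + 3 / 10000) := by
    have a1 : R * (q - ζ) ^ 2 = R * q * q - 2 * (R * q) * ζ + R * ζ ^ 2 := by ring
    rw [a1, hR]
    have a2 : -(2 * (D * q₁) * ζ) ≤ 2 * D * (1 / 10000) := by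
      have : D * q₁ * (-ζ) ≤ D * (1 / 10000) := by
        rw [mul_assoc]
        refine mul_le_mul_of_nonneg_left ?_ hD.le
        nlinarith
      linarith
    nlinarith
  have e3 : R * v ^ 2 ≤ D * (q₁ * (q - q₁) + 31 / 10000) := by
    have : D * q₁ ^ 2 ≤ D := mul_le_of_le_one_right hD.le (by nlinarith)
    nlinarith
  have e4 : 0 ≤ q₁ * (q - q₁) + 31 / 10000 := by
    by_contra hneg
    push Not at hneg
    have : D * (q₁ * (q - q₁) + 31 / 10000) < 0 := mul_neg_of_pos_of_neg hD hneg
    have : 0 ≤ R * v ^ 2 := mul_nonneg (hD.le.trans hDR) (sq_nonneg v)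
    linarith
  have e5 : v ^ 2 ≤ 31 / 10000 := by
    have a1 : D * v ^ 2 ≤ R * v ^ 2 := mul_le_mul_of_nonneg_right hDR (sq_nonneg v)
    have a0 : q₁ * (q - q₁) ≤ 0 :=
      mul_nonpos_of_nonneg_of_nonpos (by linarith) (by linarith)
    have a2 : D * v ^ 2 ≤ D * (31 / 10000) :=
      (a1.trans e3).trans (mul_le_mul_of_nonneg_left (by linarith) hD.le)
    exact le_of_mul_le_mul_left a2 hD
  have e6 : |v| ≤ 56 / 1000 := abs_le_of_sq_le_sq (by nlinarith) (by norm_num)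
  have ⟨hv1, hv2⟩ := abs_le.1 e6
  refine ⟨by nlinarith, abs_le.2 ⟨by linarith, by linarith⟩⟩

/-! ### Deterministic analysis on the noise event -/

section Deterministic

variable {V : Type*} [Fintype V] [DecidableEq V]

/-- The noise is controlled by the cut weights: its squared sum over every proper vertex set is at
most a multiple of the cardinality times the weight of the cut. -/
structure NoiseBound (G : SimpleGraph V) (w : Sym2 V → ℝ) (ε : V → ℝ) (L : ℝ) : Prop where
  proper : ∀ A ∈ properSubsets V, (∑ i ∈ A, ε i) ^ 2 ≤ 8 * L * A.card * cutWeight G w A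
  total : (∑ i, ε i) ^ 2 ≤ 8 * L * Fintype.card V

variable {G : SimpleGraph V} {w : Sym2 V → ℝ} {ε : V → ℝ} {L : ℝ}

/-- AM-GM, with the factor `|A|` in the noise bound cancelling. The first term is charged to the
quadratic gain, the second to the penalty. The full set is excluded because its cut weight vanishes.
-/
lemma NoiseBound.two_mul_le (h : NoiseBound G w ε L) {A : Finset V} (hA : A ≠ Finset.univ)
    {a : ℝ} (ha : 0 < a) (b : ℝ) :
    2 * b * ∑ i ∈ A, ε i ≤ a * A.card + 8 * L * b ^ 2 * cutWeight G w A / a := by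
  by_cases h0 : A = ∅
  · simp [h0, cutWeight_empty]
  have hk : (0 : ℝ) < A.card := by
    exact_mod_cast Finset.card_pos.2 (Finset.nonempty_iff_ne_empty.2 h0)
  have h1 := h.proper A (mem_properSubsets.2 ⟨h0, hA⟩)
  set k : ℝ := (A.card : ℝ)
  set e := ∑ i ∈ A, ε i
  set d := cutWeight G w A
  have h2 : 2 * b * e * (a * k) ≤ (a * k) ^ 2 + b ^ 2 * (8 * L * k * d) := by
    nlinarith [sq_nonneg (a * k - b * e), mul_le_mul_of_nonneg_left h1 (sq_nonneg b)]
  have h3 : (a * k + 8 * L * b ^ 2 * d / a) * (a * k) = (a * k) ^ 2 + b ^ 2 * (8 * L * k * d) := by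
    field_simp
  exact le_of_mul_le_mul_right (h2.trans h3.ge) (by positivity)

/-- Upper bound for the gain of an arbitrary split in terms of the signal on the part `T`. -/
lemma splitGain_le_of_pos (h : NoiseBound G w ε L) {A T : Finset V}
    (hA : A ≠ Finset.univ) {f₁ f₂ c m q ζ β : ℝ} (hu : f₁ ≠ f₂) (hβ : 0 < β)
    (hβc : c - m = (f₁ - f₂) * β) (hm : f₁ - m = (f₁ - f₂) * (q - ζ)) (hq : q ≤ 1) :
    splitGain (fun i => (if i ∈ T then f₁ else f₂) + ε i) A c m
      ≤ (f₁ - f₂) ^ 2 * (T.card * max (2 * β * (q - ζ) - 998 / 1000 * β ^ 2) 0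
          + 2 * Fintype.card V * ζ ^ 2) + 4000 * L * cutWeight G w A := by
  set u := f₁ - f₂ with hu'
  have hu0 : u ≠ 0 := sub_ne_zero.2 hu
  set b := c - m with hb
  have hb0 : 0 < b ^ 2 := by rw [hβc]; positivity
  -- Spending `2/1000 * b²` per vertex leaves `998/1000` of the quadratic term and costs `4000 L
  -- d(A)`, which the penalty `2 Clam L d(A)` covers once `Clam ≥ 2000`.
  have hnoise := h.two_mul_le hA (a := 2 / 1000 * b ^ 2) (by positivity) b
  have hdiv : 8 * L * b ^ 2 * cutWeight G w A / (2 / 1000 * b ^ 2)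
      = 4000 * L * cutWeight G w A := by
    rw [div_eq_iff (by positivity)]; ring
  rw [hdiv] at hnoise
  rw [splitGain_add, ← hb]
  set h₁ := 2 * β * (q - ζ) - 998 / 1000 * β ^ 2 with hh₁
  -- Off `T` the signal is on the other side of the mean up to `ζ`, so moving such a vertex towards
  -- `c` gains at most `2 ζ²` in units of `u²`.
  have hterm : ∀ i ∈ A, b * (2 * ((if i ∈ T then f₁ else f₂) - m) - b) + 2 / 1000 * b ^ 2
      ≤ u ^ 2 * ((if i ∈ T then max h₁ 0 else 0) + 2 * ζ ^ 2) := by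
    intro i _
    by_cases hi : i ∈ T
    · simp only [hi, if_true]
      have : b * (2 * (f₁ - m) - b) + 2 / 1000 * b ^ 2 = u ^ 2 * h₁ := by
        rw [hm, hβc, hh₁]; ring
      rw [this]
      exact mul_le_mul_of_nonneg_left (by nlinarith [le_max_left h₁ 0]) (sq_nonneg u)
    · simp only [hi, if_false]
      have h2 : f₂ - m = u * (q - 1 - ζ) := by linear_combination hm
      have : b * (2 * (f₂ - m) - b) + 2 / 1000 * b ^ 2
          = u ^ 2 * (2 * β * (q - 1 - ζ) - 998 / 1000 * β ^ 2) := by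
        rw [h2, hβc]; ring
      rw [this]
      refine mul_le_mul_of_nonneg_left ?_ (sq_nonneg u)
      nlinarith [sq_nonneg (β + 2 * ζ), mul_nonneg hβ.le (sub_nonneg.2 hq)]
  have hsum := Finset.sum_le_sum hterm
  rw [Finset.sum_add_distrib, Finset.sum_const, nsmul_eq_mul] at hsum
  have hcard : ∑ i ∈ A, ((if i ∈ T then max h₁ 0 else 0) + 2 * ζ ^ 2)
      ≤ T.card * max h₁ 0 + 2 * Fintype.card V * ζ ^ 2 := by
    refine (Finset.sum_le_sum_of_subset_of_nonneg (Finset.subset_univ A) fun i _ _ =>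
      add_nonneg (by split_ifs <;> simp) (by positivity)).trans (le_of_eq ?_)
    rw [Finset.sum_add_distrib, ← Finset.sum_filter]
    simp
    ring
  have := mul_le_mul_of_nonneg_left hcard (sq_nonneg u)
  rw [Finset.mul_sum] at this
  linarith

/-- If a split with value `c` beats the split along `T` with the same value and `c` is close to the
signal on `T`, then the split is close to `T`. -/
lemma card_sdiff_le_of_splitGain_le (hw : ∀ e ∈ G.edgeSet, 0 ≤ w e) (h : NoiseBound G w ε L)
    (hL : 0 ≤ L) {A T : Finset V} (hA : A ≠ Finset.univ) (hT : T ≠ Finset.univ)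
    {f₁ f₂ c m q ζ β Clam : ℝ} (hC : 640 ≤ Clam) (hu : f₁ ≠ f₂)
    (hβc : c - m = (f₁ - f₂) * β) (hm : f₁ - m = (f₁ - f₂) * (q - ζ)) (hq0 : 2 / 5 ≤ q)
    (hq : q ≤ 1) (hβ : |β - q| ≤ 8 / 100) (hζ : |ζ| ≤ 1 / 10000)
    (hle : splitGain (fun i => (if i ∈ T then f₁ else f₂) + ε i) T c m
        - 2 * (Clam * L) * cutWeight G w T
      ≤ splitGain (fun i => (if i ∈ T then f₁ else f₂) + ε i) A c m
        - 2 * (Clam * L) * cutWeight G w A) :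
    ((A \ T).card + (T \ A).card : ℝ) * (f₁ - f₂) ^ 2
      ≤ 40 * (1280 + 2 * Clam) * L * cutWeight G w T := by
  have ⟨hβ1, hβ2⟩ := abs_le.1 hβ
  have ⟨hζ1, hζ2⟩ := abs_le.1 hζ
  set u := f₁ - f₂ with hu'
  have hu0 : 0 < u ^ 2 := by have := sub_ne_zero.2 hu; positivity
  set b := c - m with hb
  have hb2 : b ^ 2 ≤ 2 * u ^ 2 := by
    have : β ^ 2 ≤ 2 := by nlinarith
    rw [hβc]; nlinarith
  have hD1 : A \ T ≠ Finset.univ := fun h' => hA (Finset.univ_subset_iff.1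
    (h' ▸ Finset.sdiff_subset))
  have hD2 : T \ A ≠ Finset.univ := fun h' => hT (Finset.univ_subset_iff.1
    (h' ▸ Finset.sdiff_subset))
  -- Each misclassified vertex loses at least `u²/20`; half of that margin is given to the noise.
  -- With `b² ≤ 2u²` the remainder is `8 * 2 * 40 = 640` times `L` times a cut weight, once for each
  -- of the two differences.
  have hn1 := h.two_mul_le hD1 (a := 1 / 40 * u ^ 2) (by positivity) b
  have hn2 := h.two_mul_le hD2 (a := 1 / 40 * u ^ 2) (by positivity) (-b)
  have hc1 := cutWeight_sdiff_le hw A T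
  have hc2 := cutWeight_sdiff_le hw T A
  have hdiv : ∀ d d' : ℝ, 0 ≤ d → d ≤ d' →
      8 * L * b ^ 2 * d / (1 / 40 * u ^ 2) ≤ 640 * L * d' := by
    intro d d' h0 h1
    rw [div_le_iff₀ (by positivity)]
    have h2 : L * b ^ 2 * d ≤ L * (2 * u ^ 2) * d' := by gcongr
    linarith
  have hd1 := hdiv _ _ (cutWeight_nonneg hw (A \ T)) hc1
  have hd2 := hdiv _ _ (cutWeight_nonneg hw (T \ A)) (hc2.trans_eq (add_comm _ _))
  rw [← neg_sq b] at hd2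
  have hs : splitGain (fun i => (if i ∈ T then f₁ else f₂) + ε i) A c m
        - splitGain (fun i => (if i ∈ T then f₁ else f₂) + ε i) T c m
      = splitGain (fun i => (if i ∈ T then f₁ else f₂) + ε i) (A \ T) c m
        - splitGain (fun i => (if i ∈ T then f₁ else f₂) + ε i) (T \ A) c m := by
    simp only [splitGain]
    rw [Finset.sum_sdiff_sub_sum_sdiff]
  have hg1 : splitGain (fun i => (if i ∈ T then f₁ else f₂) + ε i) (A \ T) c m
      ≤ (A \ T).card * (-(1 / 20) * u ^ 2) + 2 * b * ∑ i ∈ A \ T, ε i := by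
    rw [splitGain_add, ← nsmul_eq_mul]
    refine add_le_add_left (Finset.sum_le_card_nsmul _ _ _ fun i hi => ?_) _
    simp only [(Finset.mem_sdiff.1 hi).2, if_false]
    have h2 : f₂ - m = u * (q - 1 - ζ) := by linear_combination hm
    rw [h2, ← hb, hβc]
    have h3 : 8 / 25 * (9 / 10) ≤ β * (2 * (1 - q + ζ) + β) :=
      mul_le_mul (by linarith) (by linarith) (by norm_num) (by linarith)
    have h4 := mul_le_mul_of_nonneg_left h3 hu0.le
    linarith
  have hg2 : (T \ A).card * (1 / 20 * u ^ 2) + 2 * b * ∑ i ∈ T \ A, ε i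
      ≤ splitGain (fun i => (if i ∈ T then f₁ else f₂) + ε i) (T \ A) c m := by
    rw [splitGain_add, ← nsmul_eq_mul]
    refine add_le_add_left (Finset.card_nsmul_le_sum _ _ _ fun i hi => ?_) _
    simp only [(Finset.mem_sdiff.1 hi).1, if_true]
    rw [hm, ← hb, hβc]
    have h3 : 8 / 25 * (3 / 10) ≤ β * (2 * (q - ζ) - β) :=
      mul_le_mul (by linarith) (by linarith) (by norm_num) (by linarith)
    have h4 := mul_le_mul_of_nonneg_left h3 hu0.le
    linarith
  have hcA := mul_nonneg hL (cutWeight_nonneg hw A)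
  -- The two remainders give `1280 L d(A)`, absorbed by the penalty of `A`, so only `d(T)` survives.
  have hfin : 0 ≤ (Clam - 640) * (L * cutWeight G w A) := mul_nonneg (by linarith) hcA
  linarith

/-- A split whose penalized gain is almost maximal is close to the part `T` that lies on the same
side of the average as the new value. -/
lemma card_sdiff_le_of_gain_large (hw : ∀ e ∈ G.edgeSet, 0 ≤ w e) (h : NoiseBound G w ε L)
    (hL : 0 ≤ L) {A T : Finset V} (hA : A ≠ Finset.univ) (hT : T ≠ Finset.univ)
    {f₁ f₂ c m q q₁ ζ β D Clam : ℝ} (hC : 2000 ≤ Clam) (hu : f₁ ≠ f₂) (hβ : 0 < β)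
    (hβc : c - m = (f₁ - f₂) * β) (hm : f₁ - m = (f₁ - f₂) * (q - ζ))
    (hD : 0 < D) (hDT : D ≤ T.card) (hTq : T.card * q = D * q₁) (hq₁ : 1 / 2 ≤ q₁)
    (hq₁' : q₁ ≤ 1) (hq : 0 ≤ q) (hqq : q ≤ q₁) (hζ : |ζ| ≤ 1 / 10000)
    (hVζ : Fintype.card V * ζ ^ 2 ≤ (1 / 10000) ^ 2 * D)
    (hlow : (f₁ - f₂) ^ 2 * (D * (q₁ ^ 2 - 6 / 10000))
      ≤ splitGain (fun i => (if i ∈ T then f₁ else f₂) + ε i) A c m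
        - 2 * (Clam * L) * cutWeight G w A)
    (hle : splitGain (fun i => (if i ∈ T then f₁ else f₂) + ε i) T c m
        - 2 * (Clam * L) * cutWeight G w T
      ≤ splitGain (fun i => (if i ∈ T then f₁ else f₂) + ε i) A c m
        - 2 * (Clam * L) * cutWeight G w A) :
    ((A \ T).card + (T \ A).card : ℝ) * (f₁ - f₂) ^ 2
      ≤ 40 * (1280 + 2 * Clam) * L * cutWeight G w T := by
  have hu0 : 0 < (f₁ - f₂) ^ 2 := by have := sub_ne_zero.2 hu; positivity
  have hup := splitGain_le_of_pos h (T := T) hA hu hβ hβc hm (hqq.trans hq₁')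
  have hpen : 0 ≤ (Clam - 2000) * (L * cutWeight G w A) :=
    mul_nonneg (by linarith) (mul_nonneg hL (cutWeight_nonneg hw A))
  have h1 : D * (q₁ ^ 2 - 6 / 10000)
      ≤ T.card * max (2 * β * (q - ζ) - 998 / 1000 * β ^ 2) 0 + 2 * Fintype.card V * ζ ^ 2 := by
    refine le_of_mul_le_mul_left ?_ hu0
    linarith
  have h2 : D * (q₁ ^ 2 - 8 / 10000)
      ≤ T.card * max (2 * β * (q - ζ) - 998 / 1000 * β ^ 2) 0 := by
    linarith
  -- The required gain is therefore positive, so the maximum with 0 is not attained at 0.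
  have hq2 : 1 / 4 ≤ q₁ ^ 2 := by nlinarith
  have h3 : D * (q₁ ^ 2 - 8 / 10000)
      ≤ T.card * (2 * β * (q - ζ) - 998 / 1000 * β ^ 2) := by
    rcases le_total (2 * β * (q - ζ) - 998 / 1000 * β ^ 2) 0 with h' | h'
    · rw [max_eq_right h'] at h2
      have := mul_pos hD (by linarith : 0 < q₁ ^ 2 - 8 / 10000)
      linarith
    · rwa [max_eq_left h'] at h2
  have hTV : (T.card : ℝ) ≤ Fintype.card V := by exact_mod_cast Finset.card_le_univ T
  obtain ⟨hq0, hβq⟩ := close_of_gain_large hD hDT hTq hq₁ hq₁' hq hqq hζ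
    ((mul_le_mul_of_nonneg_right hTV (sq_nonneg ζ)).trans hVζ) h3
  exact card_sdiff_le_of_splitGain_le hw h hL hA hT (by linarith) hu hβc hm hq0
    (hqq.trans hq₁') hβq hζ hle

/-- The average of the noise over a part is small compared with the jump. -/
lemma NoiseBound.exists_average (h : NoiseBound G w ε L) {A : Finset V} (hA : A ∈ properSubsets V)
    {f u D : ℝ} (hu : u ≠ 0) (hDA : D ≤ A.card)
    (hsnr : 8 * L * cutWeight G w A ≤ (1 / 10000) ^ 2 * (u ^ 2 * D)) :
    ∃ χ : ℝ, |χ| ≤ 1 / 10000 ∧ ∑ i ∈ A, (f + ε i) = A.card * (f + u * χ) := by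
  have hk : (0 : ℝ) < A.card := by
    exact_mod_cast Finset.card_pos.2 (Finset.nonempty_iff_ne_empty.2 (mem_properSubsets.1 hA).1)
  have h1 := h.proper A hA
  have hu2 : 0 < u ^ 2 := by positivity
  refine ⟨(∑ i ∈ A, ε i) / (A.card * u), abs_le_of_sq_le_sq ?_ (by norm_num), ?_⟩
  · rw [div_pow, div_le_iff₀ (by positivity)]
    refine h1.trans ?_
    have h2 : 8 * L * cutWeight G w A ≤ (1 / 10000) ^ 2 * (u ^ 2 * A.card) := hsnr.trans (by gcongr)
    have := mul_le_mul_of_nonneg_left h2 hk.le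
    linarith
  · rw [Finset.sum_add_distrib, Finset.sum_const, nsmul_eq_mul]
    field_simp

omit [DecidableEq V] in
lemma average_mem_Icc {y : V → ℝ} {A : Finset V} (hA : A.Nonempty) {M : ℝ}
    (hM : ∑ i ∈ A, y i = A.card * M) : M ∈ Set.Icc (⨅ i, y i) (⨆ i, y i) := by
  have hk : (0 : ℝ) < A.card := by exact_mod_cast Finset.card_pos.2 hA
  have h1 := Finset.card_nsmul_le_sum A y (⨅ i, y i) fun i _ =>
    ciInf_le (Set.finite_range y).bddBelow i
  have h2 := Finset.sum_le_card_nsmul A y (⨆ i, y i) fun i _ =>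
    le_ciSup (Set.finite_range y).bddAbove i
  rw [hM, nsmul_eq_mul] at h1 h2
  exact ⟨le_of_mul_le_mul_left h1 hk, le_of_mul_le_mul_left h2 hk⟩

set_option maxHeartbeats 1000000 in
/-- On the event where the noise is controlled, every output of the algorithm takes two values and
splits the vertices almost along the true partition. -/
theorem IsPottsOutput.close_to_truth (hG : G.Connected)
    (hw : ∀ e ∈ G.edgeSet, effectiveResistance G e ≤ w e) (h : NoiseBound G w ε L) (hL : 0 < L)
    {S : Finset V} (hS0 : S ≠ ∅) (hS1 : S ≠ Finset.univ) (hcard : 2 * S.card ≤ Fintype.card V)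
    {f₁ f₂ Clam δ τ : ℝ} (hC : 2000 ≤ Clam) (hu : f₁ ≠ f₂)
    (hsnr : (800000000 + 10000 * Clam) * L * cutWeight G w S ≤ (f₁ - f₂) ^ 2 * S.card)
    (hδ : 0 < δ) (hδL : δ ^ 2 * Fintype.card V ≤ L) (hτ : 0 ≤ τ) (hτL : τ ≤ L) {μhat : V → ℝ}
    (hout : IsPottsOutput G (fun i => (if i ∈ S then f₁ else f₂) + ε i) δ τ (Clam * L) w μhat) :
    ∃ (A : Finset V) (c m : ℝ), c ≠ m ∧ μhat = twoValued A c m ∧ A ≠ ∅ ∧ A ≠ Finset.univ ∧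
      ∃ T : Finset V, (T = S ∨ T = Sᶜ) ∧
        ((A \ T).card + (T \ A).card : ℝ) * (f₁ - f₂) ^ 2
          ≤ 40 * (1280 + 2 * Clam) * L * cutWeight G w S := by
  have hw0 : ∀ e ∈ G.edgeSet, 0 ≤ w e := fun e he => (effectiveResistance_nonneg G e).trans (hw e he)
  have hne : Nonempty V := hG.nonempty
  have hSp : S ∈ properSubsets V := mem_properSubsets.2 ⟨hS0, hS1⟩
  have hScp : Sᶜ ∈ properSubsets V := by
    refine mem_properSubsets.2 ⟨?_, ?_⟩
    · rwa [Ne, Finset.compl_eq_empty_iff]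
    · rwa [Ne, Finset.compl_eq_univ_iff]
  have hcut : 1 ≤ cutWeight G w S := one_le_cutWeight hG hw hS0 hS1
  have hS0' := Finset.nonempty_iff_ne_empty.2 hS0
  have hD : (0 : ℝ) < S.card := by exact_mod_cast Finset.card_pos.2 hS0'
  have hDn : 2 * (S.card : ℝ) ≤ Fintype.card V := by exact_mod_cast hcard
  have hScard : ((Sᶜ).card : ℝ) = Fintype.card V - S.card := by
    rw [Finset.card_compl, Nat.cast_sub (Finset.card_le_univ S)]
  have hsumS : ∑ i ∈ S, ((if i ∈ S then f₁ else f₂) + ε i) = ∑ i ∈ S, (f₁ + ε i) :=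
    Finset.sum_congr rfl fun i hi => by simp [hi]
  have hsumSc : ∑ i ∈ Sᶜ, ((if i ∈ S then f₁ else f₂) + ε i) = ∑ i ∈ Sᶜ, (f₂ + ε i) :=
    Finset.sum_congr rfl fun i hi => by simp [Finset.mem_compl.1 hi]
  set u := f₁ - f₂ with hu'
  have hune : u ≠ 0 := sub_ne_zero.2 hu
  have hu2 : 0 < u ^ 2 := by positivity
  set D : ℝ := (S.card : ℝ) with hDdef
  set n : ℝ := (Fintype.card V : ℝ) with hn
  set d := cutWeight G w S with hd
  have hn0 : 0 < n := by linarith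
  have hLd : L ≤ L * d := le_mul_of_one_le_right hL.le hcut
  have hCd : 0 ≤ Clam * (L * d) := mul_nonneg (by linarith) (hL.le.trans hLd)
  -- The two summands of the signal-to-noise constant: `8 * 10000²` makes the noise averages at most
  -- `|u|/10000`, and `10000 * Clam` makes the penalty of the true split negligible.
  have hsnr1 : 8 * L * d ≤ (1 / 10000) ^ 2 * (u ^ 2 * D) := by linarith
  have hsnr2 : Clam * L * d ≤ 1 / 10000 * (u ^ 2 * D) := by linarith
  obtain ⟨χ₁, hχ₁, hM₁⟩ := h.exists_average (f := f₁) hSp hune le_rfl hsnr1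
  obtain ⟨χ₂, hχ₂, hM₂⟩ := h.exists_average (f := f₂) (D := D) hScp hune
    (by rw [hScard]; linarith) (by rwa [cutWeight_compl])
  rw [← hsumS] at hM₁
  rw [← hsumSc] at hM₂
  set y : V → ℝ := fun i => (if i ∈ S then f₁ else f₂) + ε i with hy
  have hyS : ∑ i, y i = D * f₁ + (n - D) * f₂ + ∑ i, ε i := by
    rw [hy, Finset.sum_add_distrib, ← Finset.sum_add_sum_compl S,
      Finset.sum_congr rfl (g := fun _ => f₁) fun i hi => by simp [hi],
      Finset.sum_congr (s₁ := Sᶜ) rfl (g := fun _ => f₂) fun i hi => by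
        simp [Finset.mem_compl.1 hi], Finset.sum_const, Finset.sum_const, nsmul_eq_mul,
      nsmul_eq_mul, hScard]
  set m := (∑ i, y i) / n with hm
  set q := 1 - D / n with hq
  set ζ := (∑ i, ε i) / (n * u) with hζ
  have hq12 : 1 / 2 ≤ q := by
    have : D / n ≤ 1 / 2 := by rw [div_le_iff₀ hn0]; linarith
    linarith
  have hDn0 : 0 < D / n := by positivity
  have hmq : f₁ - m = u * (q - ζ) := by
    rw [hm, hyS, hq, hζ, hu']
    have : f₁ - f₂ ≠ 0 := hune
    field_simp
    ring
  have hnζ : n * ζ ^ 2 ≤ (1 / 10000) ^ 2 * D := by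
    have h1 : n * ζ ^ 2 = (∑ i, ε i) ^ 2 / (n * u ^ 2) := by rw [hζ]; field_simp
    rw [h1, div_le_iff₀ (by positivity)]
    refine h.total.trans ?_
    have : 8 * L ≤ (1 / 10000) ^ 2 * (u ^ 2 * D) := by linarith
    have := mul_le_mul_of_nonneg_left this hn0.le
    linarith
  have hζ1 : |ζ| ≤ 1 / 10000 := by
    refine abs_le_of_sq_le_sq (le_of_mul_le_mul_left (hnζ.trans ?_) hn0) (by norm_num)
    linarith
  have hδu : δ ≤ 1 / 10000 * |u| := by
    refine le_of_sq_le_sq ?_ (by positivity)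
    rw [mul_pow, sq_abs]
    refine le_of_mul_le_mul_right (hδL.trans ?_) hn0
    have : u ^ 2 * D ≤ u ^ 2 * n := mul_le_mul_of_nonneg_left (by linarith) hu2.le
    linarith
  have hδsq : δ ^ 2 ≤ (1 / 10000) ^ 2 * u ^ 2 := by
    have := pow_le_pow_left₀ hδ.le hδu 2
    rwa [mul_pow, sq_abs] at this
  have hI₁ := average_mem_Icc hS0' hM₁
  have hI₂ := average_mem_Icc (Finset.nonempty_iff_ne_empty.2 (mem_properSubsets.1 hScp).1) hM₂
  have ⟨hχ₁a, hχ₁b⟩ := abs_le.1 hχ₁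
  have ⟨hχ₂a, hχ₂b⟩ := abs_le.1 hχ₂
  have ⟨hζa, hζb⟩ := abs_le.1 hζ1
  -- The data averages on the two parts both lie in the data range and differ by nearly `|u|`, so
  -- the range is long enough to contain a grid point near the average on `S`.
  have hrange : δ ≤ (⨆ i, y i) - ⨅ i, y i := by
    have h1 : |(f₁ + u * χ₁) - (f₂ + u * χ₂)| ≤ (⨆ i, y i) - ⨅ i, y i :=
      abs_le.2 ⟨by linarith [hI₁.1, hI₂.2], by linarith [hI₁.2, hI₂.1]⟩
    have h2 : (f₁ + u * χ₁) - (f₂ + u * χ₂) = u * (1 + χ₁ - χ₂) := by rw [hu']; ring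
    rw [h2, abs_mul] at h1
    have h3 : 1 / 10000 ≤ |1 + χ₁ - χ₂| := le_abs.2 (Or.inl (by linarith))
    have := mul_le_mul_of_nonneg_left h3 (abs_nonneg u)
    linarith
  obtain ⟨k, hk, hkM⟩ := exists_int_mul_mem_Icc hδ hrange hI₁
  set c₀ : ℝ := k * δ with hc₀
  have hgain₀ : u ^ 2 * (D * (q ^ 2 - 4 / 10000)) ≤ splitGain y S c₀ m := by
    rw [splitGain_eq_average y hM₁]
    have h1 : (c₀ - (f₁ + u * χ₁)) ^ 2 ≤ (1 / 10000) ^ 2 * u ^ 2 := by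
      rw [← sq_abs]
      exact (pow_le_pow_left₀ (abs_nonneg _) hkM 2).trans hδsq
    have h2 : f₁ + u * χ₁ - m = u * (q - ζ + χ₁) := by linear_combination hmq
    have h3 : q ^ 2 - 4 / 10000 + (1 / 10000) ^ 2 ≤ (q - ζ + χ₁) ^ 2 := by
      have h1 : (q - 2 / 10000) ^ 2 ≤ (q - ζ + χ₁) ^ 2 :=
        pow_le_pow_left₀ (by linarith) (by linarith) 2
      linarith
    have h4 := mul_le_mul_of_nonneg_left h3 hu2.le
    rw [h2, mul_pow]
    have h5 : u ^ 2 * (q ^ 2 - 4 / 10000)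
        ≤ u ^ 2 * (q - ζ + χ₁) ^ 2 - (c₀ - (f₁ + u * χ₁)) ^ 2 := by linarith
    have h6 := mul_le_mul_of_nonneg_left h5 hD.le
    linarith
  have hq2 : 1 / 4 ≤ q ^ 2 := by nlinarith
  have huD : 0 < u ^ 2 * D := by positivity
  have huDq : 1 / 4 * (u ^ 2 * D) ≤ q ^ 2 * (u ^ 2 * D) := mul_le_mul_of_nonneg_right hq2 huD.le
  have hc₀m : c₀ ≠ m := by
    intro h'
    rw [h'] at hgain₀
    have : splitGain y S m m = 0 := by simp [splitGain]
    linarith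
  have hlam : 0 ≤ Clam * L := mul_nonneg (by linarith) hL.le
  have hpass : pottsObjective G w (Clam * L) y (twoValued S c₀ m)
      < pottsObjective G w (Clam * L) y (fun _ => m) - τ := by
    rw [pottsObjective_twoValued_eq G w _ y S hc₀m, ← hd]
    linarith
  obtain ⟨A, c, hcm, hμ, hmin, hbest⟩ := hout.exists_minimizer hw0 hlam hτ hm ⟨⟨k, rfl⟩, hk⟩ hpass
  refine ⟨A, c, m, hcm, hμ, ?_⟩
  rw [hμ, pottsObjective_twoValued_eq G w _ y A hcm] at hmin hbest
  rw [pottsObjective_twoValued_eq G w _ y S hc₀m, ← hd] at hbest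
  -- The true split gains at least `q² - 4/10000` in units of `u² D`; its penalty costs at most a
  -- further `2/10000`.
  have hlow : u ^ 2 * (D * (q ^ 2 - 6 / 10000))
      ≤ splitGain y A c m - 2 * (Clam * L) * cutWeight G w A := by linarith
  have hlow0 : 0 < splitGain y A c m - 2 * (Clam * L) * cutWeight G w A := by linarith
  have hA0 : A ≠ ∅ := by
    rintro rfl
    rw [cutWeight_empty] at hlow0
    simp [splitGain] at hlow0
  -- Moving all vertices away from the mean `m` cannot lower the quadratic loss.
  have hA1 : A ≠ Finset.univ := by
    rintro rfl
    have hmM : ∑ i, y i = (Finset.univ : Finset V).card * m := by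
      rw [hm, Finset.card_univ, ← hn]; field_simp
    rw [cutWeight_univ, splitGain_eq_average y hmM, Finset.card_univ, ← hn] at hlow0
    have : 0 ≤ n * (c - m) ^ 2 := by positivity
    linarith
  refine ⟨hA0, hA1, ?_⟩
  have hmin' : ∀ B : Finset V, splitGain y B c m - 2 * (Clam * L) * cutWeight G w B
      ≤ splitGain y A c m - 2 * (Clam * L) * cutWeight G w A := by
    intro B
    have := hmin B
    rw [pottsObjective_twoValued_eq G w _ y B hcm] at this
    linarith
  -- The sign of `(c - m)/u` tells which part the new value approximates. For `Sᶜ` the roles are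
  -- exchanged: `u` and `ζ` change sign and `q` becomes `D/n`, with `(n - D) * (D/n) = D * (1 -
  -- D/n)` linking the two cases.
  rcases lt_or_gt_of_ne (div_ne_zero (sub_ne_zero.2 hcm) hune) with hβ | hβ
  · refine ⟨Sᶜ, Or.inr rfl, ?_⟩
    have hyc : (fun i => (if i ∈ Sᶜ then f₂ else f₁) + ε i) = y := by
      funext i
      by_cases hi : i ∈ S <;> simp [hy, hi]
    have hneg : f₂ - f₁ = -u := by rw [hu']; ring
    have := card_sdiff_le_of_gain_large (f₁ := f₂) (f₂ := f₁) (c := c) (m := m) (q := D / n)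
      (q₁ := q) (ζ := -ζ) (β := -((c - m) / u)) (D := D) hw0 h hL.le hA1
      (mem_properSubsets.1 hScp).2 hC hu.symm (by linarith) (by rw [hneg]; field_simp)
      (by rw [hneg]; linear_combination hmq) hD (by rw [hScard]; linarith)
      (by rw [hScard, hq]; field_simp) hq12 (by linarith) hDn0.le (by linarith)
      (by rwa [abs_neg]) (by rwa [neg_sq]) (by rw [hyc, hneg, neg_sq]; exact hlow)
      (by rw [hyc]; exact hmin' _)
    rwa [hneg, neg_sq, cutWeight_compl] at this
  · exact ⟨S, Or.inl rfl, card_sdiff_le_of_gain_large (f₁ := f₁) (f₂ := f₂) (c := c) (m := m)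
      (q := q) (q₁ := q) (ζ := ζ) (β := (c - m) / u) (D := D) hw0 h hL.le hA1 hS1 hC hu hβ
      (by rw [← hu']; field_simp) hmq hD le_rfl rfl hq12 (by linarith) (by linarith) le_rfl hζ1 hnζ
      hlow (hmin' _)⟩

end Deterministic

/-! ### Hausdorff distance of two-element partitions -/

section Distance

variable {V : Type*} [Fintype V] [DecidableEq V]

lemma hausdorffOneSided_le {𝒜 ℬ : Finpartition (Finset.univ : Finset V)} {d : ℕ}
    (h : ∀ A ∈ 𝒜.parts, ∃ B ∈ ℬ.parts, (symmDiff A B).card ≤ d) : hausdorffOneSided 𝒜 ℬ ≤ d := by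
  refine Finset.sup_le fun A hA => ?_
  obtain ⟨B, hB, hd⟩ := h A hA
  exact (ciInf_le (OrderBot.bddBelow _) (⟨B, hB⟩ : ℬ.parts)).trans hd

lemma mem_parts_inducedPartition {A : Finset V} {c m : ℝ} (hcm : c ≠ m) (hA0 : A ≠ ∅)
    (hA1 : A ≠ Finset.univ) (B : Finset V) :
    B ∈ (inducedPartition (twoValued A c m)).parts ↔ B = A ∨ B = Aᶜ := by
  classical
  have hpart : ∀ i, (inducedPartition (twoValued A c m)).part i = if i ∈ A then A else Aᶜ := by
    intro i
    ext j
    rw [inducedPartition, Finpartition.mem_part_ofSetoid_iff_rel, Setoid.ker_def]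
    by_cases hi : i ∈ A <;> by_cases hj : j ∈ A <;> simp [twoValued, hi, hj, hcm, hcm.symm]
  constructor
  · intro hB
    obtain ⟨i, hi⟩ := (inducedPartition (twoValued A c m)).nonempty_of_mem_parts hB
    have := (inducedPartition (twoValued A c m)).part_eq_of_mem hB hi
    rw [hpart] at this
    split_ifs at this
    · exact Or.inl this.symm
    · exact Or.inr this.symm
  · rintro (rfl | rfl)
    · obtain ⟨i, hi⟩ := Finset.nonempty_iff_ne_empty.2 hA0
      have h2 := (inducedPartition (twoValued B c m)).part_mem.2 (Finset.mem_univ i)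
      rwa [hpart, if_pos hi] at h2
    · obtain ⟨i, hi⟩ : ∃ i, i ∉ A := by
        by_contra! h
        exact hA1 (Finset.eq_univ_iff_forall.2 h)
      have h2 := (inducedPartition (twoValued A c m)).part_mem.2 (Finset.mem_univ i)
      rwa [hpart, if_neg hi] at h2

lemma symmDiff_compl_compl_finset (A B : Finset V) : symmDiff Aᶜ Bᶜ = symmDiff A B := by
  ext i
  simp only [Finset.mem_symmDiff, Finset.mem_compl]
  tauto

/-- Complementation preserves symmetric differences, so matching `A` with `T` also matches the
complements at the same cost. -/
lemma partitionDist_le {𝒜 ℬ : Finpartition (Finset.univ : Finset V)} {A T : Finset V}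
    (h𝒜 : ∀ X, X ∈ 𝒜.parts ↔ X = A ∨ X = Aᶜ) (hℬ : ∀ X, X ∈ ℬ.parts ↔ X = T ∨ X = Tᶜ) :
    partitionDist 𝒜 ℬ ≤ (A \ T).card + (T \ A).card := by
  have hcard : (symmDiff A T).card = (A \ T).card + (T \ A).card :=
    Finset.card_union_of_disjoint disjoint_sdiff_sdiff
  rw [← hcard]
  refine max_le (hausdorffOneSided_le fun X hX => ?_) (hausdorffOneSided_le fun X hX => ?_)
  · rcases (h𝒜 X).1 hX with rfl | rfl
    · exact ⟨T, (hℬ _).2 (Or.inl rfl), le_rfl⟩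
    · exact ⟨Tᶜ, (hℬ _).2 (Or.inr rfl), by rw [symmDiff_compl_compl_finset]⟩
  · rcases (hℬ X).1 hX with rfl | rfl
    · exact ⟨A, (h𝒜 _).2 (Or.inl rfl), by rw [symmDiff_comm]⟩
    · exact ⟨Aᶜ, (h𝒜 _).2 (Or.inr rfl), by rw [symmDiff_compl_compl_finset, symmDiff_comm]⟩

end Distance

/-! ### Probability of the noise event -/

section Noise

variable {V Ω : Type*} [MeasurableSpace Ω] {P : Measure Ω} [IsProbabilityMeasure P]

/-- Two-sided tail bound for the sum of independent sub-Gaussian variables over a finite set. -/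
lemma measureReal_sq_sum_gt_le {X : V → Ω → ℝ} {σ : ℝ} (hσ : 0 < σ) (hind : iIndepFun X P)
    (hsub : ∀ i, HasSubgaussianMGF (X i) (Real.toNNReal (σ ^ 2)) P) {A : Finset V}
    (hA : A.Nonempty) {t : ℝ} (ht : 0 ≤ t) :
    P.real {ω | 2 * σ ^ 2 * A.card * t < (∑ i ∈ A, X i ω) ^ 2} ≤ 2 * Real.exp (-t) := by
  have hk : (0 : ℝ) < A.card := by exact_mod_cast Finset.card_pos.2 hA
  have hsum := HasSubgaussianMGF.sum_of_iIndepFun hind (s := A) fun i _ => hsub i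
  set a := 2 * σ ^ 2 * A.card * t with ha
  have ha0 : 0 ≤ a := by positivity
  have hexp : -(√a) ^ 2 / (2 * ((∑ _i ∈ A, Real.toNNReal (σ ^ 2) : NNReal) : ℝ)) = -t := by
    rw [Real.sq_sqrt ha0, Finset.sum_const, nsmul_eq_mul, NNReal.coe_mul, NNReal.coe_natCast,
      Real.coe_toNNReal _ (sq_nonneg σ), ha]
    field_simp
  have h1 := hsum.measure_ge_le (Real.sqrt_nonneg a)
  have h2 := hsum.neg.measure_ge_le (Real.sqrt_nonneg a)
  rw [hexp] at h1 h2
  have hsubset : {ω | a < (∑ i ∈ A, X i ω) ^ 2}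
      ⊆ {ω | √a ≤ ∑ i ∈ A, X i ω} ∪ {ω | √a ≤ (-fun ω => ∑ i ∈ A, X i ω) ω} := by
    intro ω hω
    have h3 : √a ≤ |∑ i ∈ A, X i ω| := Real.sqrt_le_iff.2 ⟨abs_nonneg _, by
      rw [sq_abs]; exact le_of_lt hω⟩
    exact le_abs.1 h3
  calc _ ≤ _ := measureReal_mono hsubset
    _ ≤ _ := measureReal_union_le _ _
    _ ≤ 2 * Real.exp (-t) := by linarith

/-- The left side is the union bound with `x = W⁻⁴`. As `k ≤ W`, the power is at most `exp(W⁻³)`, so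
the total is of order `W⁻³`, and `W ≥ 4` absorbs the constants. -/
lemma pow_sub_one_le_of_le {W : ℝ} (hW : 4 ≤ W) {k : ℕ} (hk : (k : ℝ) ≤ W) :
    4 * ((1 + Real.exp (-(4 * Real.log W))) ^ k - 1) + 2 * Real.exp (-(4 * Real.log W))
      ≤ W ^ (-1 : ℝ) := by
  have hW0 : 0 < W := by linarith
  have hx : Real.exp (-(4 * Real.log W)) = (W⁻¹) ^ 4 := by
    rw [Real.exp_neg, show (4 : ℝ) * Real.log W = (4 : ℕ) * Real.log W by norm_num,
      Real.exp_nat_mul, Real.exp_log hW0, inv_pow]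
  rw [hx, Real.rpow_neg_one]
  set v := W⁻¹ with hv
  have hv0 : 0 < v := by positivity
  have hv1 : v ≤ 1 / 4 := by rw [hv, inv_le_comm₀ hW0 (by norm_num)]; linarith
  have hWv : W * v = 1 := mul_inv_cancel₀ hW0.ne'
  have hv2 : v ^ 2 ≤ 1 / 16 := by nlinarith
  have hv3 : v ^ 3 ≤ 1 / 16 * v := by
    rw [pow_succ]
    exact mul_le_mul_of_nonneg_right hv2 hv0.le
  have h1 : (1 + v ^ 4) ^ k ≤ Real.exp (v ^ 3) := by
    calc (1 + v ^ 4) ^ k ≤ Real.exp (v ^ 4) ^ k :=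
          pow_le_pow_left₀ (by positivity) (by linarith [Real.add_one_le_exp (v ^ 4)]) k
      _ = Real.exp (k * v ^ 4) := (Real.exp_nat_mul _ _).symm
      _ ≤ Real.exp (v ^ 3) := by
          refine Real.exp_le_exp.2 ((mul_le_mul_of_nonneg_right hk (by positivity)).trans_eq ?_)
          linear_combination v ^ 3 * hWv
  have h2 : Real.exp (v ^ 3) - 1 ≤ 2 * v ^ 3 := by
    have h := Real.abs_exp_sub_one_le (x := v ^ 3) (by
      rw [abs_of_pos (by positivity)]; linarith)
    rw [abs_of_pos (by positivity : 0 < v ^ 3)] at h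
    exact (le_abs_self _).trans h
  have h3 : v ^ 4 ≤ v ^ 3 := pow_le_pow_of_le_one hv0.le (by linarith) (by norm_num)
  linarith

/-- With high probability the noise is controlled by the cut weights. -/
lemma measureReal_not_noiseBound_le [Fintype V] [DecidableEq V] {G : SimpleGraph V}
    {w : Sym2 V → ℝ} (hG : G.Connected) (hw : ∀ e ∈ G.edgeSet, effectiveResistance G e ≤ w e)
    {X : V → Ω → ℝ} {σ : ℝ} (hσ : 0 < σ) (hind : iIndepFun X P)
    (hsub : ∀ i, HasSubgaussianMGF (X i) (Real.toNNReal (σ ^ 2)) P)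
    (hW : 4 ≤ totalWeight G w) :
    P.real {ω | ¬ NoiseBound G w (fun i => X i ω) (σ ^ 2 * Real.log (totalWeight G w))}
      ≤ totalWeight G w ^ (-1 : ℝ) := by
  set W := totalWeight G w with hWdef
  set s := 4 * Real.log W with hs
  have hs0 : 0 ≤ s := mul_nonneg (by norm_num) (Real.log_nonneg (by linarith))
  have hne : Nonempty V := hG.nonempty
  have hw0 : ∀ e ∈ G.edgeSet, 0 ≤ w e := fun e he => (effectiveResistance_nonneg G e).trans (hw e he)
  let bad : Finset V → ℝ → Set Ω := fun A t => {ω | 2 * σ ^ 2 * A.card * t < (∑ i ∈ A, X i ω) ^ 2}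
  -- The level `t = 4 log W * d(A)` turns `2 σ² |A| t` into `8 L |A| d(A)`. The full set has cut
  -- weight 0 and is treated separately with `t = 4 log W`.
  have hsubset : {ω | ¬ NoiseBound G w (fun i => X i ω) (σ ^ 2 * Real.log W)}
      ⊆ (⋃ A ∈ properSubsets V, bad A (s * cutWeight G w A)) ∪ bad Finset.univ s := by
    intro ω hω
    by_contra hcon
    simp only [bad, Set.mem_union, Set.mem_iUnion, Set.mem_ofPred_eq, not_or, not_exists,
      not_lt] at hcon
    refine hω ⟨fun A hA => (hcon.1 A hA).trans_eq ?_, hcon.2.trans_eq ?_⟩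
    · rw [hs]; ring
    · rw [hs, Finset.card_univ]; ring
  have h1 : P.real (⋃ A ∈ properSubsets V, bad A (s * cutWeight G w A))
      ≤ ∑ A ∈ properSubsets V, 2 * Real.exp (-(s * cutWeight G w A)) := by
    refine (measureReal_biUnion_finset_le _ _).trans (Finset.sum_le_sum fun A hA => ?_)
    exact measureReal_sq_sum_gt_le hσ hind hsub
      (Finset.nonempty_iff_ne_empty.2 (mem_properSubsets.1 hA).1)
      (mul_nonneg hs0 (cutWeight_nonneg hw0 A))
  have h2 : P.real (bad Finset.univ s) ≤ 2 * Real.exp (-s) :=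
    measureReal_sq_sum_gt_le hσ hind hsub Finset.univ_nonempty hs0
  have h3 := sum_exp_neg_cutWeight_le hG hw hs0
  have h4 : ((Fintype.card V - 1 : ℕ) : ℝ) ≤ W := by
    rw [Nat.cast_sub Fintype.card_pos, Nat.cast_one]
    exact card_sub_one_le_totalWeight hG hw
  have h5 := pow_sub_one_le_of_le hW h4
  rw [← Finset.mul_sum] at h1
  calc _ ≤ _ := measureReal_mono hsubset
    _ ≤ _ := measureReal_union_le _ _
    _ ≤ W ^ (-1 : ℝ) := by linarith

end Noise

/-! ### Model quantities for a partition into two parts -/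

section TwoParts

variable {V : Type*} [Fintype V] [DecidableEq V]

lemma exists_parts_eq_pair {𝒮 : Finpartition (Finset.univ : Finset V)} (h : 𝒮.parts.card = 2) :
    ∃ S : Finset V, S ≠ ∅ ∧ S ≠ Finset.univ ∧ 2 * S.card ≤ Fintype.card V ∧
      𝒮.parts = {S, Sᶜ} := by
  obtain ⟨S, T, hST, hparts⟩ := Finset.card_eq_two.1 h
  have hS : S ∈ 𝒮.parts := by simp [hparts]
  have hT : T ∈ 𝒮.parts := by simp [hparts]
  have hdisj : Disjoint S T := 𝒮.disjoint hS hT hST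
  have hunion : S ∪ T = Finset.univ := by
    have := 𝒮.biUnion_parts
    rwa [hparts, Finset.biUnion_insert, Finset.singleton_biUnion] at this
  have hTS : T = Sᶜ :=
    eq_compl_iff_isCompl.2 ⟨hdisj.symm, codisjoint_iff.2 ((Finset.union_comm T S).trans hunion)⟩
  have hS0 : S ≠ ∅ := 𝒮.ne_bot hS
  have hT0 : T ≠ ∅ := 𝒮.ne_bot hT
  have hcard := Finset.card_add_card_compl S
  rw [← hTS] at hcard
  have hS1 : S ≠ Finset.univ := fun h => hT0 (by rw [hTS, h, Finset.compl_univ])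
  rcases le_total S.card T.card with hle | hle
  · exact ⟨S, hS0, hS1, by omega, hTS ▸ hparts⟩
  · refine ⟨T, hT0, fun h => hS0 ?_, by omega, ?_⟩
    · rwa [hTS, Finset.compl_eq_univ_iff] at h
    · rw [hparts, hTS, compl_compl, Finset.pair_comm]

variable {G : SimpleGraph V} {𝒮 : Finpartition (Finset.univ : Finset V)} {S : Finset V}

lemma boundaryWeight_eq_cutWeight (hparts : 𝒮.parts = {S, Sᶜ}) (w : Sym2 V → ℝ) :
    boundaryWeight G w 𝒮 = cutWeight G w S := by
  unfold boundaryWeight cutWeight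
  refine Finset.sum_congr ?_ fun _ _ => rfl
  ext e
  induction e using Sym2.ind with
  | h i j =>
    simp only [Finset.mem_filter, SimpleGraph.mem_edgeFinset, SimpleGraph.mem_edgeSet, hparts,
      Finset.mem_insert, Finset.mem_singleton, exists_eq_or_imp, exists_eq_left, Sym2.mem_iff,
      forall_eq_or_imp, forall_eq, Finset.mem_compl, mk_mem_cutEdges]
    tauto

lemma minPieceSize_le (hS : S ∈ 𝒮.parts) : minPieceSize 𝒮 ≤ S.card :=
  ciInf_le (OrderBot.bddBelow _) (⟨S, hS⟩ : 𝒮.parts)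

lemma touch_compl (hG : G.Connected) (hS0 : S ≠ ∅) (hS1 : S ≠ Finset.univ) : Touch G S Sᶜ := by
  obtain ⟨e, he⟩ := cutEdges_nonempty hG hS0 hS1
  induction e using Sym2.ind with
  | h i j =>
    obtain ⟨hadj, hij⟩ := mk_mem_cutEdges.1 he
    by_cases hi : i ∈ S
    · exact ⟨i, hi, j, Finset.mem_compl.2 (by tauto), hadj⟩
    · exact ⟨j, by tauto, i, Finset.mem_compl.2 hi, hadj.symm⟩

lemma minJump_eq (hparts : 𝒮.parts = {S, Sᶜ}) (htouch : Touch G S Sᶜ) (hne : S ≠ Sᶜ)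
    (f : Finset V → ℝ) : minJump G 𝒮 f = |f S - f Sᶜ| := by
  have : {x | ∃ A ∈ 𝒮.parts, ∃ B ∈ 𝒮.parts, A ≠ B ∧ Touch G A B ∧ x = |f A - f B|}
      = {|f S - f Sᶜ|} := by
    ext x
    simp only [Set.mem_ofPred_eq, Set.mem_singleton_iff, hparts, Finset.mem_insert,
      Finset.mem_singleton]
    constructor
    · rintro ⟨A, rfl | rfl, B, rfl | rfl, hAB, -, rfl⟩
      · exact absurd rfl hAB
      · rfl
      · exact abs_sub_comm _ _
      · exact absurd rfl hAB
    · rintro rfl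
      exact ⟨S, Or.inl rfl, Sᶜ, Or.inr rfl, hne, htouch, rfl⟩
  rw [minJump, this, csInf_singleton]

end TwoParts

/-! ### Conclusion: constants and assembly -/

theorem theorem1 :
    ∃ c : ℝ, 0 < c ∧ ∃ C₀ : ℝ, 0 < C₀ ∧ ∀ Clam : ℝ, C₀ ≤ Clam → ∃ C : ℝ, 0 < C ∧
      ∀ CSNR : ℝ, 0 < CSNR → ∀ ζ : ℕ → ℝ, Tendsto ζ atTop atTop →
      ∃ N : ℕ, ∀ n : ℕ, N ≤ n →
      ∀ (Ω : Type*) [MeasurableSpace Ω] (P : Measure Ω) [IsProbabilityMeasure P]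
        (G : SimpleGraph (Fin n)) (w : Sym2 (Fin n) → ℝ)
        (Y : Fin n → Ω → ℝ) (μ : Fin n → ℝ)
        (𝒮 : Finpartition (Finset.univ : Finset (Fin n))) (f : Finset (Fin n) → ℝ)
        (σ δ τ lam : ℝ),
        IsChangePointModel G P Y μ 𝒮 f σ →
        𝒮.parts.card = 2 →
        (∀ e ∈ G.edgeSet, effectiveResistance G e ≤ w e) →
        CSNR * σ ^ 2 * boundaryWeight G w 𝒮 * Real.log (totalWeight G w) * ζ n
          ≤ minJump G 𝒮 f ^ 2 * (minPieceSize 𝒮 : ℝ) →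
        0 < δ → δ ≤ σ / Real.sqrt n →
        0 ≤ τ → τ ≤ σ ^ 2 →
        lam = Clam * σ ^ 2 * Real.log (totalWeight G w) →
        ∃ A : Set Ω, MeasurableSet A ∧
          1 - totalWeight G w ^ (-c) ≤ P.real A ∧
          ∀ ω ∈ A, ∀ μhat : Fin n → ℝ,
            IsPottsOutput G (fun i => Y i ω) δ τ lam w μhat →
            (partitionDist (inducedPartition μhat) 𝒮 : ℝ)
              ≤ C * (minJump G 𝒮 f ^ 2)⁻¹ * σ ^ 2 * boundaryWeight G w 𝒮
                  * Real.log (totalWeight G w) := by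
  refine ⟨1, one_pos, 2000, by norm_num, fun Clam hClam => ⟨40 * (1280 + 2 * Clam), by linarith,
    fun CSNR hCSNR ζ hζ => ?_⟩⟩
  obtain ⟨N₀, hN₀⟩ := eventually_atTop.1
    (hζ.eventually_ge_atTop ((800000000 + 10000 * Clam) / CSNR))
  -- From `N₀` on, the diverging factor `ζ n` exceeds the numerical constant needed, whatever
  -- `CSNR`. The 5 gives `W ≥ n - 1 ≥ 4`, hence also `log W ≥ 1`.
  refine ⟨max N₀ 5, fun n hn Ω _ P _ G w Y μ 𝒮 f σ δ τ lam hmodel hcard hw hsnr hδ hδσ hτ hτσ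
    hlam => ?_⟩
  have hζn : 800000000 + 10000 * Clam ≤ CSNR * ζ n := by
    rw [← div_le_iff₀' hCSNR]
    exact hN₀ n ((le_max_left _ _).trans hn)
  have hn5 : (5 : ℝ) ≤ n := by exact_mod_cast (le_max_right _ _).trans hn
  have hG := hmodel.connected
  have hσ := hmodel.sigma_pos
  obtain ⟨S, hS0, hS1, hScard, hparts⟩ := exists_parts_eq_pair hcard
  have hS : S ∈ 𝒮.parts := by simp [hparts]
  have hSc : Sᶜ ∈ 𝒮.parts := by simp [hparts]
  have hne : S ≠ Sᶜ := by
    intro h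
    obtain ⟨i, hi⟩ := Finset.nonempty_iff_ne_empty.2 hS0
    have hi' := hi
    rw [h] at hi'
    exact Finset.mem_compl.1 hi' hi
  have htouch := touch_compl hG hS0 hS1
  have hu : f S ≠ f Sᶜ := hmodel.jump S hS Sᶜ hSc hne htouch
  have hW : (n : ℝ) - 1 ≤ totalWeight G w := by
    simpa using card_sub_one_le_totalWeight hG hw
  rw [boundaryWeight_eq_cutWeight hparts, minJump_eq hparts htouch hne, sq_abs] at *
  set W := totalWeight G w with hWdef
  set L := σ ^ 2 * Real.log W with hLdef
  have hlog : 1 ≤ Real.log W := by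
    rw [Real.le_log_iff_exp_le (by linarith)]
    linarith [Real.exp_one_lt_d9]
  have hσL : σ ^ 2 ≤ L := le_mul_of_one_le_right (sq_nonneg σ) hlog
  have hL : 0 < L := lt_of_lt_of_le (by positivity) hσL
  have hcut := one_le_cutWeight hG hw hS0 hS1
  have hpiece : (minPieceSize 𝒮 : ℝ) ≤ S.card := by exact_mod_cast minPieceSize_le hS
  have hsnr' : (800000000 + 10000 * Clam) * L * cutWeight G w S
      ≤ (f S - f Sᶜ) ^ 2 * S.card := by
    have h1 := mul_le_mul_of_nonneg_right hζn
      (mul_nonneg hL.le (zero_le_one.trans hcut) : 0 ≤ L * cutWeight G w S)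
    have h2 := mul_le_mul_of_nonneg_left hpiece (sq_nonneg (f S - f Sᶜ))
    have h3 : CSNR * σ ^ 2 * cutWeight G w S * Real.log W * ζ n
        = CSNR * ζ n * (L * cutWeight G w S) := by rw [hLdef]; ring
    linarith
  have hδL : δ ^ 2 * Fintype.card (Fin n) ≤ L := by
    rw [Fintype.card_fin]
    have h1 := pow_le_pow_left₀ hδ.le hδσ 2
    rw [div_pow, Real.sq_sqrt (by linarith), le_div_iff₀ (by linarith)] at h1
    exact h1.trans hσL
  have hbad := measureReal_not_noiseBound_le hG hw hσ hmodel.indep hmodel.subgaussian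
    (by linarith : 4 ≤ totalWeight G w)
  -- The complement of a measurable hull of the bad event: measurable, contained in the good event,
  -- and subject to the same probability bound.
  refine ⟨(toMeasurable P {ω | ¬ NoiseBound G w (fun i => Y i ω - μ i) L})ᶜ,
    (measurableSet_toMeasurable _ _).compl, ?_, fun ω hω μhat hout => ?_⟩
  · rw [probReal_compl_eq_one_sub (measurableSet_toMeasurable _ _), measureReal_def,
      measure_toMeasurable, ← measureReal_def]
    linarith
  have hnoise : NoiseBound G w (fun i => Y i ω - μ i) L := by
    by_contra hcon
    exact hω (subset_toMeasurable P _ hcon)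
  have hY : (fun i => Y i ω)
      = fun i => (if i ∈ S then f S else f Sᶜ) + (fun i => Y i ω - μ i) i := by
    funext i
    by_cases hi : i ∈ S
    · simp [hi, hmodel.piecewise_const S hS i hi]
    · simp [hi, hmodel.piecewise_const Sᶜ hSc i (Finset.mem_compl.2 hi)]
  rw [hY, hlam, mul_assoc, ← hLdef] at hout
  obtain ⟨A, c, m, hcm, rfl, hA0, hA1, T, hT, hclose⟩ := hout.close_to_truth hG hw hnoise hL hS0
    hS1 hScard hClam hu hsnr' hδ hδL hτ (hτσ.trans hσL)
  have hparts' : ∀ X, X ∈ 𝒮.parts ↔ X = T ∨ X = Tᶜ := by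
    intro X
    rw [hparts, Finset.mem_insert, Finset.mem_singleton]
    rcases hT with rfl | rfl
    · rfl
    · rw [compl_compl, or_comm]
  have hdist : (partitionDist (inducedPartition (twoValued A c m)) 𝒮 : ℝ)
      ≤ (A \ T).card + (T \ A).card := by
    exact_mod_cast partitionDist_le (mem_parts_inducedPartition hcm hA0 hA1) hparts'
  have hu2 : 0 < (f S - f Sᶜ) ^ 2 := by have := sub_ne_zero.2 hu; positivity
  refine hdist.trans (((le_div_iff₀ hu2).2 hclose).trans_eq ?_)
  rw [hLdef, div_eq_mul_inv]
  ring
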